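/- Let $\Gamma$ be a finite metric graph (loops and multiple edges allowed), each edge $e$ being a segment $[0,L_e]$ with $0<L_e<\infty$, with a real potential $V\in L_2(\Gamma)$ and with self-adjoint vertex conditions $A_vF(v)+B_vF'(v)=0$ at every vertex $v$. Here $F(v),F'(v)\in\mathbb C^{d_v}$ collect the values at $v$ of $f$ and of its derivatives (taken into the edges) along the edge ends attached to $v$, the $d_v\times d_v$ matrices $A_v,B_v$ are such that $(A_v\,B_v)$ has maximal rank and $A_vB_v^*$ is self-adjoint. Let $\mathcal H=-\frac{d^2}{dx^2}+V$ be the Hamiltonian whose domain consists of the functions $f$ that lie in $H^2(e)$ on each edge $e$ and satisfy the vertex conditions. Let $e_0$ be a loose edge of $\Gamma$, of length $s_0$: the vertex at its end $x=s_0$ has degree $1$; let the condition at this vertex be the Dirichlet condition $f=0$. Let the potential on $e_0$ be given as a function in $L_2(0,b)$ with $b>s_0$. For $s$ near $s_0$ let $\Gamma_s$ be the quantum graph obtained from $\Gamma$ by changing the length of $e_0$ to $s$ (so that $e_0$ becomes $[0,s]$ with the potential restricted to it), keeping everything else. Let $\lambda_0$ be a simple eigenvalue of $\Gamma=\Gamma_{s_0}$.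 Then there are $\varepsilon,\delta>0$ and a function $\lambda$ on $(s_0-\varepsilon,s_0+\varepsilon)$ with $\lambda(s_0)=\lambda_0$ such that for every $s$ with $|s-s_0|<\varepsilon$ the graph $\Gamma_s$ is a quantum graph as above, $\lambda(s)$ is a simple eigenvalue of $\Gamma_s$ and is the only eigenvalue of $\Gamma_s$ in $(\lambda_0-\delta,\lambda_0+\delta)$, and $\lambda$ is differentiable at $s$ with $$\frac{d\lambda}{ds}(s)=-\left|f_s'(s)\right|^2$$ for every eigenfunction $f_s$ of $\Gamma_s$ with eigenvalue $\lambda(s)$ and $\|f_s\|_{L_2(\Gamma_s)}=1$, where $f_s'(s)$ is the derivative of $f_s$ along $e_0$ at its Dirichlet end $x=s$. -/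

import Mathlib

open MeasureTheory Set Filter Topology
open scoped Matrix

/-- `MemSobolevH2 L f g` : the function `f`, restricted to `[0, L]`, is (the continuously
differentiable representative of) an element of the Sobolev space `H²(0, L)`, and `g ∈ L²(0, L)` is
its second weak derivative. That is: `f` is differentiable on `[0, L]` (one-sidedly at the two ends)
and `f'` is absolutely continuous with density `g`, i.e. `f'(x) = f'(0) + ∫₀ˣ g`. -/
structure MemSobolevH2 (L : ℝ) (f g : ℝ → ℂ) : Prop where
  differentiableOn : DifferentiableOn ℝ f (Icc 0 L)
  memLp : MemLp g 2 (volume.restrict (Ioo 0 L))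
  derivWithin_eq : ∀ x ∈ Icc 0 L,
    derivWithin f (Icc 0 L) x = derivWithin f (Icc 0 L) 0 + ∫ t in (0 : ℝ)..x, g t

/-- The data of a quantum graph with vertex set `V` and edge set `E` (loops and multiple edges are
allowed). The edge `e` is the segment `[0, length e]` with coordinate `x`. Its two ends are the
pairs `(e, false)` (the end `x = 0`) and `(e, true)` (the end `x = length e`), and `vertex` says to
which vertex an end is attached. So the ends attached to `v` form the type
`{b // vertex b = v}`, whose cardinality is the degree of `v`.
On each edge there is a real potential, of which only the values on `[0, length e]` matter.
The vertex condition at `v` is `A v * F(v) + B v * F'(v) = 0`. -/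
structure QuantumGraph (V E : Type*) where
  vertex : E × Bool → V
  length : E → ℝ
  potential : E → ℝ → ℝ
  A : ∀ v : V, Matrix {b : E × Bool // vertex b = v} {b : E × Bool // vertex b = v} ℂ
  B : ∀ v : V, Matrix {b : E × Bool // vertex b = v} {b : E × Bool // vertex b = v} ℂ

namespace QuantumGraph

variable {V E : Type*}

/-- The ends of edges attached to `v`. -/
abbrev EndsAt (Γ : QuantumGraph V E) (v : V) : Type _ := {b : E × Bool // Γ.vertex b = v}

/-- The conditions making the data a quantum graph with self-adjoint Hamiltonian
`-d²/dx² + potential`: positive lengths, square integrable potential, and at each vertex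
`(A v  B v)` has maximal rank and `A v * (B v)*` is self-adjoint. -/
structure IsSelfAdjoint [Fintype E] [DecidableEq V] (Γ : QuantumGraph V E) : Prop where
  length_pos : ∀ e, 0 < Γ.length e
  potential_memLp : ∀ e, MemLp (Γ.potential e) 2 (volume.restrict (Ioo 0 (Γ.length e)))
  rank_eq : ∀ v, (Matrix.fromCols (Γ.A v) (Γ.B v)).rank = Fintype.card (Γ.EndsAt v)
  isHermitian : ∀ v, (Γ.A v * (Γ.B v)ᴴ).IsHermitian

/-- The graph obtained by changing the length of the edge `e` to `s`, keeping everything else. -/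
def withLength [DecidableEq E] (Γ : QuantumGraph V E) (e : E) (s : ℝ) : QuantumGraph V E :=
  { Γ with length := Function.update Γ.length e s }

/-- The derivative of `f` along the edge `e`, in the coordinate `x` of that edge
(one-sided at the ends of the edge). -/
noncomputable def edgeDeriv (Γ : QuantumGraph V E) (f : E → ℝ → ℂ) (e : E) (x : ℝ) : ℂ :=
  derivWithin (f e) (Icc 0 (Γ.length e)) x

/-- The value of `f` at an end of an edge. -/
def endValue (Γ : QuantumGraph V E) (f : E → ℝ → ℂ) : E × Bool → ℂ
  | (e, false) => f e 0
  | (e, true) => f e (Γ.length e)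

/-- The derivative of `f` at an end of an edge, taken away from the vertex and into the edge. -/
noncomputable def endDeriv (Γ : QuantumGraph V E) (f : E → ℝ → ℂ) : E × Bool → ℂ
  | (e, false) => Γ.edgeDeriv f e 0
  | (e, true) => -Γ.edgeDeriv f e (Γ.length e)

/-- The vector `F(v)` of the values of `f` at `v` along the edges incident to `v`. -/
def vertexValue (Γ : QuantumGraph V E) (f : E → ℝ → ℂ) (v : V) : Γ.EndsAt v → ℂ :=
  fun b => Γ.endValue f b.1

/-- The vector `F'(v)` of the derivatives of `f` at `v` along the edges incident to `v`. -/
noncomputable def vertexDeriv (Γ : QuantumGraph V E) (f : E → ℝ → ℂ) (v : V) : Γ.EndsAt v → ℂ :=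
  fun b => Γ.endDeriv f b.1

/-- A function on the graph is given by its components `f e`, of which only the values on
`[0, length e]` matter. `f` is in the domain of the Hamiltonian, with second derivative `g`: it is
`H²` on each edge and satisfies the vertex conditions. -/
structure MemDomain [Fintype E] [DecidableEq V] (Γ : QuantumGraph V E) (f g : E → ℝ → ℂ) :
    Prop where
  memSobolevH2 : ∀ e, MemSobolevH2 (Γ.length e) (f e) (g e)
  vertexCondition : ∀ v, Γ.A v *ᵥ Γ.vertexValue f v + Γ.B v *ᵥ Γ.vertexDeriv f v = 0

/-- `f` is in the domain of the Hamiltonian `H` and `H f = lam f`, i.e. `f` belongs to the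
eigenspace `ker (H - lam)`. -/
def MemEigenspace [Fintype E] [DecidableEq V] (Γ : QuantumGraph V E) (lam : ℝ)
    (f : E → ℝ → ℂ) : Prop :=
  ∃ g : E → ℝ → ℂ, Γ.MemDomain f g ∧ ∀ e, ∀ᵐ x ∂volume.restrict (Ioo 0 (Γ.length e)),
    -g e x + (Γ.potential e x : ℂ) * f e x = (lam : ℂ) * f e x

/-- `f` is an eigenfunction with eigenvalue `lam`: a nonzero element of `ker (H - lam)`. -/
def IsEigenfunction [Fintype E] [DecidableEq V] (Γ : QuantumGraph V E) (lam : ℝ)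
    (f : E → ℝ → ℂ) : Prop :=
  Γ.MemEigenspace lam f ∧ ∃ e, ∃ x ∈ Icc 0 (Γ.length e), f e x ≠ 0

/-- `lam` is an eigenvalue of the Hamiltonian. -/
def IsEigenvalue [Fintype E] [DecidableEq V] (Γ : QuantumGraph V E) (lam : ℝ) : Prop :=
  ∃ f, Γ.IsEigenfunction lam f

/-- `lam` is a simple eigenvalue: as a space of functions on the graph, `ker (H - lam)` is
one-dimensional. -/
def IsSimpleEigenvalue [Fintype E] [DecidableEq V] (Γ : QuantumGraph V E) (lam : ℝ) : Prop :=
  ∃ f, Γ.IsEigenfunction lam f ∧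
    ∀ h, Γ.MemEigenspace lam h → ∃ c : ℂ, ∀ e, ∀ x ∈ Icc 0 (Γ.length e), h e x = c * f e x

/-- The `L²(Γ)` norm of `f` equals one. -/
def IsNormalized [Fintype E] (Γ : QuantumGraph V E) (f : E → ℝ → ℂ) : Prop :=
  ∑ e, ∫ x in (0 : ℝ)..Γ.length e, ‖f e x‖ ^ 2 = 1

/-- `e` is a loose edge: the vertex at its end `x = length e` has degree one. -/
def IsLooseEdge (Γ : QuantumGraph V E) (e : E) : Prop :=
  ∀ b : E × Bool, Γ.vertex b = Γ.vertex (e, true) → b = (e, true)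

/-- The vertex condition at `v` is the Dirichlet condition `F(v) = 0`. -/
def IsDirichletAt [Fintype E] [DecidableEq V] (Γ : QuantumGraph V E) (v : V) : Prop :=
  ∀ F F' : Γ.EndsAt v → ℂ, Γ.A v *ᵥ F + Γ.B v *ᵥ F' = 0 ↔ F = 0

end QuantumGraph

/-! Eigenvalues are tracked through a bordered boundary value problem, which needs only continuity
in the length and the spectral parameter. Let `p` be the eigenfunction for `lam₀`, continued past
the ends of the edges. On every edge solve `u'' = (w - lam) u + τ p`; the unknowns are the initial
values and slopes on all edges and one scalar `τ`. The equations are the vertex conditions, with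
`e₀` of length `s`, and `⟨u, p⟩ = 1`. Simplicity of `lam₀` makes the homogeneous system
nondegenerate at `(s₀, lam₀)` (`injective_boundaryMap`), so it has a unique solution `F(s, lam)`
nearby, depending continuously on `(s, lam)`. Close to `(s₀, lam₀)`, `lam` is an eigenvalue of `Γ_s`
exactly when `τ(s, lam) = 0`, and the eigenspace is then spanned by `F`.

Everything else is Green's identity (`graph_green`), whose boundary terms cancel because
self-adjoint vertex conditions are Lagrangian. Pairing `F` with itself shows that `τ` is real.
Pairing with `p` at `s = s₀` gives `τ = (lam - lam₀) / ‖p‖²`. This changes sign, so the intermediate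
value theorem yields zeros `lam(s)` for nearby `s` (`exists_zero_branch`). Pairing two solutions
with `τ = 0` at the same `s` gives `(lam - mu) ⟨F, F̃⟩ = 0`, where the pairing is nonzero by
continuity; hence the eigenvalue is unique.

For two lengths `s`, `t` only the Dirichlet end contributes (`green_of_isLooseEdge`): `(lam t - lam
s) ⟨F_t, F_s⟩ = -(∫_s^t F_t') conj (F_s'(s))`. This first forces `lam` to be continuous at `s`;
dividing by `t - s` then gives the derivative `-|F_s'(s)|² / ‖F_s‖²` (`hasDerivAt_of_quotient`). -/

open scoped ComplexConjugate BoundedContinuousFunction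

/-! ### Absolutely continuous functions on a segment -/

/-- On `[0, L]`, the function `f` is absolutely continuous with density `h`. -/
structure IsPrimitiveOn (L : ℝ) (f h : ℝ → ℂ) : Prop where
  intervalIntegrable : IntervalIntegrable h volume 0 L
  eq_add_integral : ∀ x ∈ Icc 0 L, f x = f 0 + ∫ t in (0 : ℝ)..x, h t

namespace IsPrimitiveOn

variable {L : ℝ} {f g h k v w : ℝ → ℂ}

lemma mono_right (hf : IsPrimitiveOn L f h) {x : ℝ} (hx : x ∈ Icc 0 L) :
    IsPrimitiveOn x f h where
  intervalIntegrable := hf.intervalIntegrable.mono_set (by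
    rw [uIcc_of_le hx.1, uIcc_of_le (hx.1.trans hx.2)]
    exact Icc_subset_Icc_right hx.2)
  eq_add_integral y hy := hf.eq_add_integral y ⟨hy.1, hy.2.trans hx.2⟩

lemma continuousOn (hf : IsPrimitiveOn L f h) (hL : 0 ≤ L) : ContinuousOn f (Icc 0 L) := by
  have h1 : ContinuousOn (fun x => ∫ t in (0 : ℝ)..x, h t) (Icc 0 L) := by
    have := intervalIntegral.continuousOn_primitive_interval' hf.intervalIntegrable
      (left_mem_uIcc)
    rwa [uIcc_of_le hL] at this
  exact (continuousOn_const.add h1).congr hf.eq_add_integral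

lemma conj_comp (hf : IsPrimitiveOn L f h) :
    IsPrimitiveOn L (fun x => conj (f x)) (fun x => conj (h x)) where
  intervalIntegrable :=
    ⟨Complex.conjCLE.toContinuousLinearMap.integrable_comp hf.intervalIntegrable.1,
      Complex.conjCLE.toContinuousLinearMap.integrable_comp hf.intervalIntegrable.2⟩
  eq_add_integral x hx := by
    have := (hf.mono_right hx).intervalIntegrable
    rw [hf.eq_add_integral x hx, map_add]
    congr 1
    exact (Complex.conjCLE.toContinuousLinearMap.intervalIntegral_comp_comm this).symm

/-- Product rule almost everywhere together with the fundamental theorem for absolutely continuous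
functions. The densities are merely integrable, as second derivatives of `H²` functions are, so a
continuous version would not suffice. -/
lemma _root_.integral_deriv_mul_primitive {h k : ℝ → ℝ} (hh : IntervalIntegrable h volume 0 L)
    (hk : IntervalIntegrable k volume 0 L) (c d : ℝ) :
    ∫ x in (0 : ℝ)..L, (h x * (d + ∫ t in (0 : ℝ)..x, k t)
      + (c + ∫ t in (0 : ℝ)..x, h t) * k x) =
    (c + ∫ t in (0 : ℝ)..L, h t) * (d + ∫ t in (0 : ℝ)..L, k t) - c * d := by
  have key : ∀ {h : ℝ → ℝ}, IntervalIntegrable h volume 0 L → ∀ c : ℝ,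
      AbsolutelyContinuousOnInterval (fun x => c + ∫ t in (0 : ℝ)..x, h t) 0 L ∧
      ∀ᵐ x, x ∈ uIcc 0 L → HasDerivAt (fun x => c + ∫ t in (0 : ℝ)..x, h t) (h x) x := by
    intro h hh c
    refine ⟨?_, ?_⟩
    · have h1 : AbsolutelyContinuousOnInterval (fun _ : ℝ => c) 0 L := by
        have := (LipschitzWith.const c).lipschitzOnWith (s := uIcc 0 L)
        exact this.absolutelyContinuousOnInterval
      exact h1.add (hh.absolutelyContinuousOnInterval_intervalIntegral left_mem_uIcc)
    · filter_upwards [hh.ae_hasDerivAt_integral] with x hx hxm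
      exact (hx hxm 0 left_mem_uIcc).const_add c
  obtain ⟨h1, h2⟩ := key hh c
  obtain ⟨k1, k2⟩ := key hk d
  have := h1.integral_deriv_mul_eq_sub k1
  simp only [intervalIntegral.integral_same, add_zero] at this
  rw [← this]
  apply intervalIntegral.integral_congr_ae
  filter_upwards [h2, k2] with x hx kx hxm
  have hxm' := uIoc_subset_uIcc hxm
  rw [(hx hxm').deriv, (kx hxm').deriv]

lemma re (hf : IsPrimitiveOn L f h) :
    IntervalIntegrable (fun x => (h x).re) volume 0 L ∧
    ∀ x ∈ Icc 0 L, (f x).re = (f 0).re + ∫ t in (0 : ℝ)..x, (h t).re := by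
  refine ⟨⟨Complex.reCLM.integrable_comp hf.intervalIntegrable.1,
      Complex.reCLM.integrable_comp hf.intervalIntegrable.2⟩, fun x hx => ?_⟩
  rw [hf.eq_add_integral x hx, Complex.add_re]
  congr 1
  exact (Complex.reCLM.intervalIntegral_comp_comm (hf.mono_right hx).intervalIntegrable).symm

lemma im (hf : IsPrimitiveOn L f h) :
    IntervalIntegrable (fun x => (h x).im) volume 0 L ∧
    ∀ x ∈ Icc 0 L, (f x).im = (f 0).im + ∫ t in (0 : ℝ)..x, (h t).im := by
  refine ⟨⟨Complex.imCLM.integrable_comp hf.intervalIntegrable.1,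
      Complex.imCLM.integrable_comp hf.intervalIntegrable.2⟩, fun x hx => ?_⟩
  rw [hf.eq_add_integral x hx, Complex.add_im]
  congr 1
  exact (Complex.imCLM.intervalIntegral_comp_comm (hf.mono_right hx).intervalIntegrable).symm

lemma mul_integrable (hL : 0 ≤ L) (hf : IsPrimitiveOn L f h)
    (hk : IntervalIntegrable k volume 0 L) :
    IntervalIntegrable (fun x => f x * k x) volume 0 L :=
  hk.continuousOn_mul (by rw [uIcc_of_le hL]; exact hf.continuousOn hL)

lemma integral_deriv_mul (hL : 0 ≤ L) (hf : IsPrimitiveOn L f h) (hg : IsPrimitiveOn L g k) :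
    ∫ x in (0 : ℝ)..L, (h x * g x + f x * k x) = f L * g L - f 0 * g 0 := by
  have hreal : ∀ {f g h k : ℝ → ℝ}, (IntervalIntegrable h volume 0 L ∧
      ∀ x ∈ Icc 0 L, f x = f 0 + ∫ t in (0 : ℝ)..x, h t) →
      (IntervalIntegrable k volume 0 L ∧ ∀ x ∈ Icc 0 L, g x = g 0 + ∫ t in (0 : ℝ)..x, k t) →
      ∫ x in (0 : ℝ)..L, (h x * g x + f x * k x) = f L * g L - f 0 * g 0 := by
    intro f g h k hf hg
    rw [hf.2 L ⟨hL, le_rfl⟩, hg.2 L ⟨hL, le_rfl⟩, ← integral_deriv_mul_primitive hf.1 hg.1]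
    apply intervalIntegral.integral_congr
    intro x hx
    rw [uIcc_of_le hL] at hx
    simp only [hf.2 x hx, hg.2 x hx]
  have hint : IntervalIntegrable (fun x => h x * g x + f x * k x) volume 0 L := by
    refine IntervalIntegrable.add ?_ (hf.mul_integrable hL hg.intervalIntegrable)
    simpa only [mul_comm] using hg.mul_integrable hL hf.intervalIntegrable
  have hcont : ∀ {f : ℝ → ℝ} {h : ℝ → ℝ}, IntervalIntegrable h volume 0 L ∧
      (∀ x ∈ Icc 0 L, f x = f 0 + ∫ t in (0 : ℝ)..x, h t) → ContinuousOn f (uIcc 0 L) := by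
    intro f h hf
    have h1 := intervalIntegral.continuousOn_primitive_interval' hf.1 (left_mem_uIcc)
    refine ((continuousOn_const (c := f 0)).add h1).congr ?_
    rw [uIcc_of_le hL]
    exact hf.2
  have hii : ∀ {f g h k : ℝ → ℝ}, (IntervalIntegrable h volume 0 L ∧
      ∀ x ∈ Icc 0 L, f x = f 0 + ∫ t in (0 : ℝ)..x, h t) →
      (IntervalIntegrable k volume 0 L ∧ ∀ x ∈ Icc 0 L, g x = g 0 + ∫ t in (0 : ℝ)..x, k t) →
      IntervalIntegrable (fun x => h x * g x + f x * k x) volume 0 L := fun hf hg =>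
    (hf.1.mul_continuousOn (hcont hg)).add (hg.1.continuousOn_mul (hcont hf))
  apply Complex.ext
  · have := Complex.reCLM.intervalIntegral_comp_comm hint
    simp only [Complex.reCLM_apply] at this
    rw [← this]
    have e1 := hreal hf.re hg.re
    have e2 := hreal hf.im hg.im
    have e3 := intervalIntegral.integral_sub (hii hf.re hg.re) (hii hf.im hg.im)
    simp only [Complex.sub_re, Complex.mul_re]
    rw [show (f L).re * (g L).re - (f L).im * (g L).im - ((f 0).re * (g 0).re
      - (f 0).im * (g 0).im) = ((f L).re * (g L).re - (f 0).re * (g 0).re)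
      - ((f L).im * (g L).im - (f 0).im * (g 0).im) by ring, ← e1, ← e2, ← e3]
    congr 1
    ext x
    simp only [Complex.add_re, Complex.mul_re]
    ring
  · have := Complex.imCLM.intervalIntegral_comp_comm hint
    simp only [Complex.imCLM_apply] at this
    rw [← this]
    have e1 := hreal hf.re hg.im
    have e2 := hreal hf.im hg.re
    have e3 := intervalIntegral.integral_add (hii hf.re hg.im) (hii hf.im hg.re)
    simp only [Complex.sub_im, Complex.mul_im]
    rw [show (f L).re * (g L).im + (f L).im * (g L).re - ((f 0).re * (g 0).im
      + (f 0).im * (g 0).re) = ((f L).re * (g L).im - (f 0).re * (g 0).im)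
      + ((f L).im * (g L).re - (f 0).im * (g 0).re) by ring, ← e1, ← e2, ← e3]
    congr 1
    ext x
    simp only [Complex.add_im, Complex.mul_im]
    ring

/-- Green's identity on a segment. -/
lemma green (hL : 0 ≤ L) (hf : IsPrimitiveOn L f v) (hv : IsPrimitiveOn L v h)
    (hg : IsPrimitiveOn L g w) (hw : IsPrimitiveOn L w k) :
    ∫ x in (0 : ℝ)..L, (h x * conj (g x) - f x * conj (k x)) =
      (v L * conj (g L) - f L * conj (w L)) - (v 0 * conj (g 0) - f 0 * conj (w 0)) := by
  have e1 := hv.integral_deriv_mul hL hg.conj_comp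
  have e2 := hf.integral_deriv_mul hL hw.conj_comp
  have i1 : IntervalIntegrable (fun x => h x * conj (g x) + v x * conj (w x)) volume 0 L := by
    refine IntervalIntegrable.add ?_ (hv.mul_integrable hL hg.conj_comp.intervalIntegrable)
    simpa only [mul_comm] using hg.conj_comp.mul_integrable hL hv.intervalIntegrable
  have i2 : IntervalIntegrable (fun x => v x * conj (w x) + f x * conj (k x)) volume 0 L := by
    refine IntervalIntegrable.add ?_ (hf.mul_integrable hL hw.conj_comp.intervalIntegrable)
    simpa only [mul_comm] using hw.conj_comp.mul_integrable hL hf.intervalIntegrable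
  have e3 := intervalIntegral.integral_sub i1 i2
  rw [e1, e2] at e3
  rw [show (v L * conj (g L) - f L * conj (w L)) - (v 0 * conj (g 0) - f 0 * conj (w 0)) =
    v L * conj (g L) - v 0 * conj (g 0) - (f L * conj (w L) - f 0 * conj (w 0)) by ring, ← e3]
  congr 1
  ext x
  ring

lemma hasDerivWithinAt (hf : IsPrimitiveOn L f h) (hh : ContinuousOn h (Icc 0 L))
    {x : ℝ} (hx : x ∈ Icc 0 L) : HasDerivWithinAt f (h x) (Icc 0 L) x := by
  have := fact_iff.2 hx
  have h1 : HasDerivWithinAt (fun u => ∫ t in (0 : ℝ)..u, h t) (h x) (Icc 0 L) x :=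
    intervalIntegral.integral_hasDerivWithinAt_right (hf.mono_right hx).intervalIntegrable
      (hh.stronglyMeasurableAtFilter_nhdsWithin measurableSet_Icc x) (hh x hx)
  exact (h1.const_add (f 0)).congr hf.eq_add_integral (hf.eq_add_integral x hx)

/-- Uniqueness for `f'' = w f` with `w` only in `L¹`. Feeding a bound on `f` back into the two
integral equations gains one factor `W x / (n + 1)` per round: the first integration freezes the
increasing bound at its right end and costs `W`, the second gains the power of `x`. The resulting
bounds `C (W x)ⁿ / n!` tend to zero. -/
lemma eq_zero_of_linear (hL : 0 ≤ L) (hf : IsPrimitiveOn L f v) (hv : IsPrimitiveOn L v h)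
    (hw : IntervalIntegrable w volume 0 L) (hh : ∀ᵐ x ∂volume.restrict (Ioo 0 L), h x = w x * f x)
    (hf0 : f 0 = 0) (hv0 : v 0 = 0) : ∀ x ∈ Icc 0 L, f x = 0 := by
  set W := ∫ t in (0 : ℝ)..L, ‖w t‖ with hW
  have hW0 : 0 ≤ W := intervalIntegral.integral_nonneg hL fun _ _ => norm_nonneg _
  obtain ⟨C, hC⟩ := isCompact_Icc.exists_bound_of_continuousOn (hf.continuousOn hL)
  have hC0 : 0 ≤ C := (norm_nonneg _).trans (hC 0 ⟨le_rfl, hL⟩)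
  have hbound : ∀ n : ℕ, ∀ x ∈ Icc 0 L, ‖f x‖ ≤ C * ((W * x) ^ n / n.factorial) := by
    intro n
    induction n with
    | zero => simpa using hC
    | succ n ih =>
      have hvb : ∀ y ∈ Icc 0 L, ‖v y‖ ≤ W * (C * ((W * y) ^ n / n.factorial)) := by
        intro y hy
        rw [hv.eq_add_integral y hy, hv0, zero_add]
        set D := C * ((W * y) ^ n / n.factorial)
        have hD : 0 ≤ D := by have := hy.1; positivity
        have hwy : IntervalIntegrable w volume 0 y := hw.mono_set (by
          rw [uIcc_of_le hy.1, uIcc_of_le hL]; exact Icc_subset_Icc_right hy.2)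
        have h1 : ‖∫ t in (0 : ℝ)..y, h t‖ ≤ ∫ t in (0 : ℝ)..y, ‖w t‖ * D := by
          apply intervalIntegral.norm_integral_le_of_norm_le hy.1 _ (hwy.norm.mul_const D)
          have h2 : ∀ᵐ t ∂volume, t ∈ Ioo 0 L → h t = w t * f t :=
            (ae_restrict_iff' measurableSet_Ioo).1 hh
          have h3 : ∀ᵐ t : ℝ ∂volume, t ≠ L := by simp [ae_iff, measure_singleton]
          filter_upwards [h2, h3] with t ht htL htm
          rw [ht ⟨htm.1, lt_of_le_of_ne (htm.2.trans hy.2) htL⟩, norm_mul]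
          gcongr
          refine (ih t ⟨htm.1.le, htm.2.trans hy.2⟩).trans ?_
          have := htm.1.le
          have := htm.2
          simp only [D]
          gcongr
        refine h1.trans ?_
        rw [intervalIntegral.integral_mul_const]
        gcongr
        exact intervalIntegral.integral_mono_interval le_rfl hy.1 hy.2
          (Eventually.of_forall fun _ => norm_nonneg _) hw.norm
      intro x hx
      rw [hf.eq_add_integral x hx, hf0, zero_add]
      have h1 : ‖∫ t in (0 : ℝ)..x, v t‖ ≤
          ∫ t in (0 : ℝ)..x, W * (C * ((W * t) ^ n / n.factorial)) := by
        apply intervalIntegral.norm_integral_le_of_norm_le hx.1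
        · exact Eventually.of_forall fun t ht => hvb t ⟨ht.1.le, ht.2.trans hx.2⟩
        · exact (by fun_prop : Continuous _).intervalIntegrable _ _
      refine h1.trans (le_of_eq ?_)
      have h2 : ∀ t : ℝ, W * (C * ((W * t) ^ n / n.factorial)) =
          C * W ^ (n + 1) / n.factorial * t ^ n := fun t => by rw [mul_pow]; ring
      simp_rw [h2]
      rw [intervalIntegral.integral_const_mul, integral_pow, Nat.factorial_succ]
      have : (n.factorial : ℝ) ≠ 0 := by positivity
      push_cast
      field_simp
      ring
  intro x hx
  have h1 := (FloorSemiring.tendsto_pow_div_factorial_atTop (W * x)).const_mul C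
  rw [mul_zero] at h1
  have := ge_of_tendsto' h1 fun n => hbound n x hx
  exact norm_le_zero_iff.1 this

end IsPrimitiveOn

namespace MemSobolevH2

variable {L : ℝ} {f g v : ℝ → ℂ}

lemma isPrimitiveOn_derivWithin (hL : 0 ≤ L) (hf : MemSobolevH2 L f g) :
    IsPrimitiveOn L (derivWithin f (Icc 0 L)) g where
  intervalIntegrable := by
    rw [intervalIntegrable_iff_integrableOn_Ioo_of_le hL]
    exact hf.memLp.integrable one_le_two
  eq_add_integral := hf.derivWithin_eq

lemma isPrimitiveOn (hL : 0 ≤ L) (hf : MemSobolevH2 L f g) :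
    IsPrimitiveOn L f (derivWithin f (Icc 0 L)) := by
  have hc := (hf.isPrimitiveOn_derivWithin hL).continuousOn hL
  refine ⟨ContinuousOn.intervalIntegrable (by rwa [uIcc_of_le hL]), fun x hx => ?_⟩
  have hsub : Icc 0 x ⊆ Icc 0 L := Icc_subset_Icc_right hx.2
  rw [intervalIntegral.integral_eq_sub_of_hasDerivAt_of_le hx.1
    (hf.differentiableOn.continuousOn.mono hsub)]
  · ring
  · intro y hy
    exact (hf.differentiableOn y (hsub (Ioo_subset_Icc_self hy))).hasDerivWithinAt.hasDerivAt
      (Icc_mem_nhds hy.1 (hy.2.trans_le hx.2))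
  · exact ContinuousOn.intervalIntegrable (by rw [uIcc_of_le hx.1]; exact hc.mono hsub)

end MemSobolevH2

lemma IsPrimitiveOn.derivWithin_eq {L : ℝ} {f v g : ℝ → ℂ} (hL : 0 < L) (hf : IsPrimitiveOn L f v)
    (hv : IsPrimitiveOn L v g) {x : ℝ} (hx : x ∈ Icc 0 L) :
    derivWithin f (Icc 0 L) x = v x :=
  (hf.hasDerivWithinAt (hv.continuousOn hL.le) hx).derivWithin (uniqueDiffOn_Icc hL x hx)

lemma IsPrimitiveOn.memSobolevH2 {L : ℝ} {f v g : ℝ → ℂ} (hL : 0 < L) (hf : IsPrimitiveOn L f v)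
    (hv : IsPrimitiveOn L v g) (hg : MemLp g 2 (volume.restrict (Ioo 0 L))) :
    MemSobolevH2 L f g where
  differentiableOn _ hx :=
    (hf.hasDerivWithinAt (hv.continuousOn hL.le) hx).differentiableWithinAt
  memLp := hg
  derivWithin_eq x hx := by
    rw [hf.derivWithin_eq hL hv hx, hf.derivWithin_eq hL hv ⟨le_rfl, hL.le⟩]
    exact hv.eq_add_integral x hx

/-! ### Volterra operators on bounded continuous functions -/

/-- The operator `u ↦ (x ↦ ∫₀ˣ w u)` on bounded continuous functions. -/
noncomputable def weightedPrimitive (w : ℝ → ℂ) (hw : Integrable w) : (ℝ →ᵇ ℂ) →L[ℂ] (ℝ →ᵇ ℂ) :=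
  have hi : ∀ u : ℝ →ᵇ ℂ, Integrable fun t => w t * u t := fun u =>
    hw.mul_bdd u.continuous.aestronglyMeasurable (Eventually.of_forall u.norm_coe_le_norm)
  have hb : ∀ (u : ℝ →ᵇ ℂ) (x : ℝ),
      ‖∫ t in (0 : ℝ)..x, w t * u t‖ ≤ (∫ t, ‖w t‖) * ‖u‖ := fun u x => by
    refine (intervalIntegral.norm_integral_le_integral_norm_uIoc).trans ?_
    refine (setIntegral_le_integral (hi u).norm (Eventually.of_forall fun _ => norm_nonneg _)).trans
      ?_
    rw [← integral_mul_const]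
    refine integral_mono (hi u).norm (hw.norm.mul_const _) fun t => ?_
    simp only [norm_mul]
    gcongr
    exact u.norm_coe_le_norm t
  LinearMap.mkContinuous
    { toFun := fun u => BoundedContinuousFunction.ofNormedAddCommGroup
        (fun x => ∫ t in (0 : ℝ)..x, w t * u t)
        (intervalIntegral.continuous_primitive (fun _ _ => (hi u).intervalIntegrable) 0) _ (hb u)
      map_add' := fun u v => by
        ext x
        simp only [BoundedContinuousFunction.coe_ofNormedAddCommGroup,
          BoundedContinuousFunction.coe_add, Pi.add_apply, mul_add]
        exact intervalIntegral.integral_add (hi u).intervalIntegrable (hi v).intervalIntegrable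
      map_smul' := fun c u => by
        ext x
        simp only [BoundedContinuousFunction.coe_ofNormedAddCommGroup,
          BoundedContinuousFunction.coe_smul, smul_eq_mul, RingHom.id_apply]
        rw [← intervalIntegral.integral_const_mul]
        congr 1
        ext t
        ring } (∫ t, ‖w t‖) fun u =>
      (BoundedContinuousFunction.norm_le (mul_nonneg (integral_nonneg fun _ => norm_nonneg _)
        (norm_nonneg _))).2 (hb u)

lemma weightedPrimitive_apply {w : ℝ → ℂ} (hw : Integrable w) (u : ℝ →ᵇ ℂ) (x : ℝ) :
    weightedPrimitive w hw u x = ∫ t in (0 : ℝ)..x, w t * u t := rfl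

lemma integrable_indicator_Icc (R : ℝ) : Integrable ((Icc 0 R).indicator (1 : ℝ → ℂ)) :=
  (integrable_indicator_iff measurableSet_Icc).2
    (integrableOn_const (by simp))

/-- The primitive `x ↦ ∫₀ˣ u`, stopped outside `[0, R]`. -/
noncomputable def stoppedPrimitive (R : ℝ) : (ℝ →ᵇ ℂ) →L[ℂ] (ℝ →ᵇ ℂ) :=
  weightedPrimitive _ (integrable_indicator_Icc R)

lemma stoppedPrimitive_apply {R x : ℝ} (hx : x ∈ Icc 0 R) (u : ℝ →ᵇ ℂ) :
    stoppedPrimitive R u x = ∫ t in (0 : ℝ)..x, u t := by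
  rw [stoppedPrimitive, weightedPrimitive_apply]
  apply intervalIntegral.integral_congr
  intro t ht
  rw [uIcc_of_le hx.1] at ht
  simp [indicator_of_mem (show t ∈ Icc 0 R from ⟨ht.1, ht.2.trans hx.2⟩)]

lemma stoppedPrimitive_of_nonpos {R x : ℝ} (hx : x ≤ 0) (u : ℝ →ᵇ ℂ) :
    stoppedPrimitive R u x = 0 := by
  rw [stoppedPrimitive, weightedPrimitive_apply, intervalIntegral.integral_symm, neg_eq_zero]
  apply intervalIntegral.integral_zero_ae
  have h3 : ∀ᵐ t : ℝ ∂volume, t ≠ 0 := by simp [ae_iff, measure_singleton]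
  filter_upwards [h3] with t ht htm
  rw [uIoc_of_le hx] at htm
  rw [indicator_of_notMem, zero_mul]
  exact fun h => ht (le_antisymm htm.2 h.1)

lemma stoppedPrimitive_of_ge {R x : ℝ} (hx : R ≤ x) (u : ℝ →ᵇ ℂ) :
    stoppedPrimitive R u x = stoppedPrimitive R u R := by
  have hi : Integrable fun t => (Icc 0 R).indicator (1 : ℝ → ℂ) t * u t :=
    (integrable_indicator_Icc R).mul_bdd u.continuous.aestronglyMeasurable
      (Eventually.of_forall u.norm_coe_le_norm)
  rw [stoppedPrimitive, weightedPrimitive_apply, weightedPrimitive_apply,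
    ← intervalIntegral.integral_add_adjacent_intervals (b := R) hi.intervalIntegrable
      hi.intervalIntegrable, add_eq_left]
  apply intervalIntegral.integral_zero_ae
  refine Eventually.of_forall fun t htm => ?_
  rw [uIoc_of_le hx] at htm
  rw [indicator_of_notMem, zero_mul]
  exact fun h => htm.1.not_ge h.2

/-- Reduces sup norm estimates on the line to estimates on `[0, R]`. -/
lemma exists_mem_Icc_stoppedPrimitive_eq {R : ℝ} (hR : 0 ≤ R) (u : ℝ →ᵇ ℂ) (x : ℝ) :
    ∃ y ∈ Icc 0 R, stoppedPrimitive R u x = stoppedPrimitive R u y := by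
  rcases le_total x 0 with h | h
  · exact ⟨0, ⟨le_rfl, hR⟩, by
      rw [stoppedPrimitive_of_nonpos h, stoppedPrimitive_of_nonpos le_rfl]⟩
  rcases le_total x R with h' | h'
  · exact ⟨x, ⟨h, h'⟩, rfl⟩
  · exact ⟨R, ⟨hR, le_rfl⟩, stoppedPrimitive_of_ge h' u⟩

/-- The Volterra operator `K` need not be a contraction, but its powers satisfy `‖Kⁿ‖ ≤ (W R)ⁿ / n!`
for `n ≥ 1`. So some `1 - Kⁿ⁺¹` is invertible by a Neumann series, and `1 - K` is one of its
commuting factors. -/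
lemma isUnit_one_sub_stoppedPrimitive_comp {R : ℝ} (hR : 0 ≤ R) {w : ℝ → ℂ} (hw : Integrable w) :
    IsUnit (1 - (stoppedPrimitive R).comp (weightedPrimitive w hw)) := by
  set K := (stoppedPrimitive R).comp (weightedPrimitive w hw) with hK
  set W := ∫ t, ‖w t‖ with hW
  have hW0 : 0 ≤ W := integral_nonneg fun _ => norm_nonneg _
  have hbound : ∀ (u : ℝ →ᵇ ℂ) (n : ℕ), ∀ x ∈ Icc 0 R,
      ‖(K ^ n) u x‖ ≤ ‖u‖ * ((W * x) ^ n / n.factorial) := by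
    intro u n
    induction n with
    | zero => intro x _; simpa using u.norm_coe_le_norm x
    | succ n ih =>
      intro x hx
      rw [pow_succ', mul_apply_eq_comp]
      set g := (K ^ n) u
      have hv : ∀ y ∈ Icc 0 R, ‖weightedPrimitive w hw g y‖ ≤
          W * (‖u‖ * ((W * y) ^ n / n.factorial)) := by
        intro y hy
        rw [weightedPrimitive_apply]
        set D := ‖u‖ * ((W * y) ^ n / n.factorial)
        have hD : 0 ≤ D := by have := hy.1; positivity
        have h1 : ‖∫ t in (0 : ℝ)..y, w t * g t‖ ≤ ∫ t in (0 : ℝ)..y, ‖w t‖ * D := by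
          apply intervalIntegral.norm_integral_le_of_norm_le hy.1 _
            (hw.norm.mul_const D).intervalIntegrable
          refine Eventually.of_forall fun t htm => ?_
          rw [norm_mul]
          gcongr
          refine (ih t ⟨htm.1.le, htm.2.trans hy.2⟩).trans ?_
          have := htm.1.le
          have := htm.2
          simp only [D]
          gcongr
        refine h1.trans ?_
        rw [intervalIntegral.integral_mul_const]
        gcongr
        rw [intervalIntegral.integral_of_le hy.1]
        exact setIntegral_le_integral hw.norm (Eventually.of_forall fun _ => norm_nonneg _)
      rw [hK, ContinuousLinearMap.comp_apply, stoppedPrimitive_apply hx]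
      have h1 : ‖∫ t in (0 : ℝ)..x, weightedPrimitive w hw g t‖ ≤
          ∫ t in (0 : ℝ)..x, W * (‖u‖ * ((W * t) ^ n / n.factorial)) := by
        apply intervalIntegral.norm_integral_le_of_norm_le hx.1
        · exact Eventually.of_forall fun t ht => hv t ⟨ht.1.le, ht.2.trans hx.2⟩
        · exact (by fun_prop : Continuous _).intervalIntegrable _ _
      refine h1.trans (le_of_eq ?_)
      have h2 : ∀ t : ℝ, W * (‖u‖ * ((W * t) ^ n / n.factorial)) =
          ‖u‖ * W ^ (n + 1) / n.factorial * t ^ n := fun t => by rw [mul_pow]; ring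
      simp_rw [h2]
      rw [intervalIntegral.integral_const_mul, integral_pow, Nat.factorial_succ]
      have : (n.factorial : ℝ) ≠ 0 := by positivity
      push_cast
      field_simp
      ring
  have hnorm : ∀ n : ℕ, ‖K ^ (n + 1)‖ ≤ (W * R) ^ (n + 1) / (n + 1).factorial := by
    intro n
    refine ContinuousLinearMap.opNorm_le_bound _ (by positivity) fun u => ?_
    rw [BoundedContinuousFunction.norm_le (by positivity)]
    intro x
    have h1 : ∃ y ∈ Icc 0 R, (K ^ (n + 1)) u x = (K ^ (n + 1)) u y := by
      rw [pow_succ', mul_apply_eq_comp]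
      exact exists_mem_Icc_stoppedPrimitive_eq hR _ x
    obtain ⟨y, hy, hxy⟩ := h1
    rw [hxy, mul_comm]
    refine (hbound u (n + 1) y hy).trans ?_
    have := hy.1
    have := hy.2
    gcongr
  have hlim := (FloorSemiring.tendsto_pow_div_factorial_atTop (W * R)).comp (tendsto_add_atTop_nat 1)
  obtain ⟨n, hn⟩ := (hlim.eventually (gt_mem_nhds one_pos)).exists
  have hu : IsUnit (1 - K ^ (n + 1)) :=
    isUnit_one_sub_of_norm_lt_one (R := (ℝ →ᵇ ℂ) →L[ℂ] (ℝ →ᵇ ℂ)) ((hnorm n).trans_lt hn)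
  have hc : Commute (1 - K) (∑ i ∈ Finset.range (n + 1), K ^ i) :=
    Commute.sum_right _ _ _ fun i _ => (Commute.one_left _).sub_left (Commute.self_pow K i)
  rw [← mul_neg_geom_sum] at hu
  exact (hc.isUnit_mul_iff.1 hu).1

/-! ### Solutions of the inhomogeneous equation on one edge -/

namespace Volterra

variable {w : ℝ → ℂ} (hw : Integrable w) (R : ℝ) (p : ℝ →ᵇ ℂ)

/-- The operator `u ↦ (x ↦ ∫₀ˣ (w - lam) u)`. -/
noncomputable def slopeKernel (lam : ℝ) : (ℝ →ᵇ ℂ) →L[ℂ] (ℝ →ᵇ ℂ) :=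
  weightedPrimitive w hw - (lam : ℂ) • stoppedPrimitive R

/-- The slope `u'` of the solution of `u'' = (w - lam) u + τ p`, without the contribution of
`(w - lam) u`, as a function of `(u 0, u' 0, τ)`. -/
noncomputable def slopeDatum : ℂ × ℂ × ℂ →L[ℂ] (ℝ →ᵇ ℂ) :=
  ((ContinuousLinearMap.fst ℂ ℂ ℂ).comp (ContinuousLinearMap.snd ℂ ℂ (ℂ × ℂ))).smulRight 1 +
  ((ContinuousLinearMap.snd ℂ ℂ ℂ).comp (ContinuousLinearMap.snd ℂ ℂ (ℂ × ℂ))).smulRight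
    (stoppedPrimitive R p)

/-- The solution `u` of `u'' = (w - lam) u + τ p` on `[0, R]`, as a function of
`(u 0, u' 0, τ)`. -/
noncomputable def sol (lam : ℝ) : ℂ × ℂ × ℂ →L[ℂ] (ℝ →ᵇ ℂ) :=
  (Ring.inverse (1 - (stoppedPrimitive R).comp (slopeKernel hw R lam))).comp
    ((ContinuousLinearMap.fst ℂ ℂ (ℂ × ℂ)).smulRight 1 +
      (stoppedPrimitive R).comp (slopeDatum R p))

/-- The derivative of `sol`. -/
noncomputable def slope (lam : ℝ) : ℂ × ℂ × ℂ →L[ℂ] (ℝ →ᵇ ℂ) :=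
  slopeDatum R p + (slopeKernel hw R lam).comp (sol hw R p lam)

lemma slopeKernel_apply (lam : ℝ) (u : ℝ →ᵇ ℂ) (x : ℝ) :
    slopeKernel hw R lam u x =
      ∫ t in (0 : ℝ)..x, (w t - lam * (Icc 0 R).indicator (1 : ℝ → ℂ) t) * u t := by
  have hi : ∀ {w : ℝ → ℂ}, Integrable w → Integrable fun t => w t * u t := fun hw =>
    hw.mul_bdd u.continuous.aestronglyMeasurable (Eventually.of_forall u.norm_coe_le_norm)
  have h1 := (hi (integrable_indicator_Icc R)).const_mul (lam : ℂ)
  simp only [slopeKernel, stoppedPrimitive, sub_apply,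
    smul_apply, BoundedContinuousFunction.coe_sub, Pi.sub_apply,
    BoundedContinuousFunction.coe_smul, weightedPrimitive_apply, smul_eq_mul]
  rw [← intervalIntegral.integral_const_mul, ← intervalIntegral.integral_sub
    (hi hw).intervalIntegrable h1.intervalIntegrable]
  congr 1
  ext t
  ring

/-- Cutting `lam` off outside `[0, R]` keeps the weight integrable, so the invertibility lemma
applies for every `lam`. -/
lemma slopeKernel_eq (lam : ℝ) : slopeKernel hw R lam =
    weightedPrimitive (fun t => w t - lam * (Icc 0 R).indicator (1 : ℝ → ℂ) t)
      (hw.sub ((integrable_indicator_Icc R).const_mul _)) := by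
  ext u x
  rw [slopeKernel_apply, weightedPrimitive_apply]

variable {R}

lemma isUnit (hR : 0 ≤ R) (lam : ℝ) :
    IsUnit (1 - (stoppedPrimitive R).comp (slopeKernel hw R lam)) := by
  rw [slopeKernel_eq]
  exact isUnit_one_sub_stoppedPrimitive_comp hR _

lemma sol_eq (hR : 0 ≤ R) (lam : ℝ) (z : ℂ × ℂ × ℂ) :
    sol hw R p lam z = z.1 • 1 + stoppedPrimitive R (slope hw R p lam z) := by
  have h1 : (1 - (stoppedPrimitive R).comp (slopeKernel hw R lam)) (sol hw R p lam z) =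
      z.1 • 1 + stoppedPrimitive R (slopeDatum R p z) := by
    rw [sol, ContinuousLinearMap.comp_apply, ← mul_apply_eq_comp,
      Ring.mul_inverse_cancel _ (isUnit hw hR lam)]
    simp
  simp only [sub_apply, one_apply_eq_self,
    ContinuousLinearMap.comp_apply] at h1
  rw [slope, add_apply, map_add, ContinuousLinearMap.comp_apply, ← add_assoc,
    ← h1]
  abel

lemma continuous_slopeKernel : Continuous (slopeKernel hw R) := by
  unfold slopeKernel
  fun_prop

lemma continuous_sol (hR : 0 ≤ R) : Continuous (sol hw R p) := by
  have h1 : Continuous fun lam => Ring.inverse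
      (1 - (stoppedPrimitive R).comp (slopeKernel hw R lam)) := by
    rw [continuous_iff_continuousAt]
    intro lam
    obtain ⟨U, hU⟩ := isUnit hw hR lam
    have h2 := NormedRing.inverse_continuousAt (R := (ℝ →ᵇ ℂ) →L[ℂ] (ℝ →ᵇ ℂ)) U
    rw [hU] at h2
    have h3 : Continuous fun lam => 1 - (stoppedPrimitive R).comp (slopeKernel hw R lam) :=
      continuous_const.sub (continuous_const.clm_comp (continuous_slopeKernel hw))
    exact ContinuousAt.comp (f := fun lam => 1 - (stoppedPrimitive R).comp (slopeKernel hw R lam))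
      h2 h3.continuousAt
  exact h1.clm_comp continuous_const

lemma continuous_slope (hR : 0 ≤ R) : Continuous (slope hw R p) :=
  continuous_const.add ((continuous_slopeKernel hw).clm_comp (continuous_sol hw p hR))

lemma sol_zero (hR : 0 ≤ R) (lam : ℝ) (z : ℂ × ℂ × ℂ) : sol hw R p lam z 0 = z.1 := by
  rw [sol_eq hw p hR]
  simp [stoppedPrimitive_of_nonpos le_rfl]

lemma slope_zero (lam : ℝ) (z : ℂ × ℂ × ℂ) : slope hw R p lam z 0 = z.2.1 := by
  simp [slope, slopeDatum, stoppedPrimitive_of_nonpos le_rfl, slopeKernel_apply]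

variable {p}

lemma isPrimitiveOn_sol {l : ℝ} (hl : 0 ≤ l) (hlR : l ≤ R) (lam : ℝ) (z : ℂ × ℂ × ℂ) :
    IsPrimitiveOn l (sol hw R p lam z) (slope hw R p lam z) where
  intervalIntegrable := (slope hw R p lam z).continuous.intervalIntegrable _ _
  eq_add_integral x hx := by
    rw [sol_zero hw p (hl.trans hlR)]
    nth_rw 1 [sol_eq hw p (hl.trans hlR)]
    simp [stoppedPrimitive_apply (Icc_subset_Icc_right hlR hx)]

lemma isPrimitiveOn_slope {l : ℝ} (hl : 0 ≤ l) (hlR : l ≤ R) (lam : ℝ) (z : ℂ × ℂ × ℂ) :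
    IsPrimitiveOn l (slope hw R p lam z)
      (fun x => (w x - lam) * sol hw R p lam z x + z.2.2 * p x) := by
  have h1 : IntervalIntegrable (fun x => (w x - lam) * sol hw R p lam z x) volume 0 l :=
    (hw.intervalIntegrable.sub intervalIntegrable_const).mul_continuousOn
      (sol hw R p lam z).continuous.continuousOn
  have h2 : IntervalIntegrable (fun x => z.2.2 * p x) volume 0 l :=
    (continuous_const.mul p.continuous).intervalIntegrable _ _
  refine ⟨h1.add h2, fun x hx => ?_⟩
  have hsub : uIcc 0 x ⊆ uIcc 0 l := by
    rw [uIcc_of_le hx.1, uIcc_of_le hl]; exact Icc_subset_Icc_right hx.2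
  rw [slope_zero, intervalIntegral.integral_add (h1.mono_set hsub) (h2.mono_set hsub),
    intervalIntegral.integral_const_mul, ← stoppedPrimitive_apply (Icc_subset_Icc_right hlR hx)]
  simp only [slope, slopeDatum, add_apply, ContinuousLinearMap.comp_apply,
    BoundedContinuousFunction.coe_add, Pi.add_apply, ContinuousLinearMap.smulRight_apply,
    BoundedContinuousFunction.coe_smul, slopeKernel_apply, ContinuousLinearMap.coe_fst',
    ContinuousLinearMap.coe_snd', smul_eq_mul, BoundedContinuousFunction.coe_one, Pi.one_apply,
    mul_one]
  rw [add_assoc, add_comm (z.2.2 * _)]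
  congr 2
  -- The cutoff in the kernel equals `1` on `[0, l] ⊆ [0, R]`, so the true equation holds there.
  apply intervalIntegral.integral_congr
  intro t ht
  rw [uIcc_of_le hx.1] at ht
  simp [indicator_of_mem (show t ∈ Icc 0 R from ⟨ht.1, ht.2.trans (hx.2.trans hlR)⟩)]

end Volterra

/-! ### Self-adjoint vertex conditions and cancellation of boundary terms -/

open scoped ComplexOrder in
/-- A self-adjoint vertex condition defines a Lagrangian subspace. -/
lemma Matrix.dotProduct_star_comm_of_selfAdjoint_condition {n : Type*} [Fintype n]
    {A B : Matrix n n ℂ} (hrank : (Matrix.fromCols A B).rank = Fintype.card n)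
    (hAB : (A * Bᴴ).IsHermitian) {F F' G G' : n → ℂ} (hF : A *ᵥ F + B *ᵥ F' = 0)
    (hG : A *ᵥ G + B *ᵥ G' = 0) : F' ⬝ᵥ star G = F ⬝ᵥ star G' := by
  classical
  set C := Matrix.fromCols A B with hC
  -- The columns of `D` solve the vertex condition by self-adjointness, and they are independent
  -- since `(A B)` has full rank. By dimension they span all solutions, which are thus `F = B* x`,
  -- `F' = -A* x`; the claim then reduces to `A B* = B A*`.
  set D := Matrix.fromRows Bᴴ (-Aᴴ) with hD
  have hAB' : A * Bᴴ = B * Aᴴ := by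
    have := hAB.eq
    rwa [Matrix.conjTranspose_mul, Matrix.conjTranspose_conjTranspose, eq_comm] at this
  have hCD : C * D = 0 := by
    rw [hC, hD, Matrix.fromCols_mul_fromRows, hAB']
    simp
  have hCker : Module.finrank ℂ (LinearMap.ker C.mulVecLin) = Fintype.card n := by
    have h1 := LinearMap.finrank_range_add_finrank_ker C.mulVecLin
    have h2 : Module.finrank ℂ (LinearMap.range C.mulVecLin) = Fintype.card n := hrank
    rw [h2, Module.finrank_fintype_fun_eq_card, Fintype.card_sum] at h1
    omega
  have hDinj : LinearMap.ker D.mulVecLin = ⊥ := by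
    have hCt : LinearMap.ker Cᴴ.mulVecLin = ⊥ := by
      have h1 := LinearMap.finrank_range_add_finrank_ker Cᴴ.mulVecLin
      have h2 : Module.finrank ℂ (LinearMap.range Cᴴ.mulVecLin) = Fintype.card n := by
        rw [← hrank, ← Matrix.rank_conjTranspose C]; rfl
      rw [h2, Module.finrank_fintype_fun_eq_card] at h1
      exact Submodule.finrank_eq_zero.1 (by omega)
    rw [LinearMap.ker_eq_bot'] at hCt ⊢
    intro x hx
    apply hCt
    rw [Matrix.mulVecLin_apply] at hx ⊢
    rw [hD, Matrix.fromRows_mulVec] at hx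
    rw [hC, Matrix.conjTranspose_fromCols_eq_fromRows_conjTranspose, Matrix.fromRows_mulVec]
    ext i
    rcases i with i | i
    · have := congrFun hx (Sum.inr i)
      simpa [Matrix.neg_mulVec] using this
    · simpa using congrFun hx (Sum.inl i)
  have hDrange : LinearMap.range D.mulVecLin = LinearMap.ker C.mulVecLin := by
    apply Submodule.eq_of_le_of_finrank_eq
    · rintro _ ⟨x, rfl⟩
      simp [Matrix.mulVec_mulVec, hCD]
    · rw [hCker, LinearMap.finrank_range_of_inj (LinearMap.ker_eq_bot.1 hDinj),
        Module.finrank_fintype_fun_eq_card]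
  have hsol : ∀ {F F' : n → ℂ}, A *ᵥ F + B *ᵥ F' = 0 →
      ∃ x, F = Bᴴ *ᵥ x ∧ F' = -(Aᴴ *ᵥ x) := by
    intro F F' h
    have h1 : Sum.elim F F' ∈ LinearMap.ker C.mulVecLin := by
      rw [LinearMap.mem_ker, Matrix.mulVecLin_apply, hC, Matrix.fromCols_mulVec_sumElim, h]
    rw [← hDrange] at h1
    obtain ⟨x, hx⟩ := h1
    rw [Matrix.mulVecLin_apply, hD, Matrix.fromRows_mulVec] at hx
    refine ⟨x, ?_, ?_⟩
    · ext i; exact (congrFun hx (Sum.inl i)).symm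
    · ext i
      have := (congrFun hx (Sum.inr i)).symm
      simpa [Matrix.neg_mulVec] using this
  obtain ⟨x, rfl, rfl⟩ := hsol hF
  obtain ⟨y, rfl, rfl⟩ := hsol hG
  rw [star_neg, Matrix.star_mulVec, Matrix.star_mulVec, Matrix.conjTranspose_conjTranspose,
    Matrix.conjTranspose_conjTranspose, neg_dotProduct, dotProduct_neg,
    dotProduct_comm, ← Matrix.dotProduct_mulVec, dotProduct_comm (Bᴴ *ᵥ x),
    ← Matrix.dotProduct_mulVec, Matrix.mulVec_mulVec, Matrix.mulVec_mulVec, hAB']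

namespace QuantumGraph

variable {V E : Type*}

/-- The value of `f` at an end of an edge, the edges having lengths `l`. -/
def boundaryValue (l : E → ℝ) (f : E → ℝ → ℂ) : E × Bool → ℂ
  | (e, false) => f e 0
  | (e, true) => f e (l e)

/-- The derivative into the edge at an end of an edge, for a function with derivative `v`. -/
def boundarySlope (l : E → ℝ) (v : E → ℝ → ℂ) : E × Bool → ℂ
  | (e, false) => v e 0
  | (e, true) => -v e (l e)

/-- The left hand side of the vertex condition at `x` for a function `f` with derivative `v`. -/
noncomputable def vertexForm [Fintype E] [DecidableEq V] (Γ : QuantumGraph V E) (l : E → ℝ)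
    (f v : E → ℝ → ℂ) (x : V) : Γ.EndsAt x → ℂ :=
  Γ.A x *ᵥ (fun b => boundaryValue l f b.1) + Γ.B x *ᵥ (fun b => boundarySlope l v b.1)

lemma sum_edge_boundary [Fintype E] (l : E → ℝ) (f v g w : E → ℝ → ℂ) :
    ∑ e, ((v e (l e) * conj (g e (l e)) - f e (l e) * conj (w e (l e))) -
      (v e 0 * conj (g e 0) - f e 0 * conj (w e 0))) =
    ∑ b, (boundaryValue l f b * conj (boundarySlope l w b) -
      boundarySlope l v b * conj (boundaryValue l g b)) := by
  rw [Fintype.sum_prod_type]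
  refine Finset.sum_congr rfl fun e _ => ?_
  rw [Fintype.sum_bool]
  simp only [boundaryValue, boundarySlope, map_neg]
  ring

variable [Fintype E] [DecidableEq V] {Γ : QuantumGraph V E}

lemma IsSelfAdjoint.vertex_boundary_eq_zero (hΓ : Γ.IsSelfAdjoint) {l : E → ℝ}
    {f v g w : E → ℝ → ℂ} {x : V} (hf : Γ.vertexForm l f v x = 0) (hg : Γ.vertexForm l g w x = 0) :
    ∑ b : Γ.EndsAt x, (boundaryValue l f b.1 * conj (boundarySlope l w b.1) -
      boundarySlope l v b.1 * conj (boundaryValue l g b.1)) = 0 := by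
  have := Matrix.dotProduct_star_comm_of_selfAdjoint_condition (hΓ.rank_eq x) (hΓ.isHermitian x)
    hf hg
  rw [Finset.sum_sub_distrib, sub_eq_zero]
  exact this.symm

lemma IsSelfAdjoint.boundary_eq_zero [Finite V] (hΓ : Γ.IsSelfAdjoint) {l : E → ℝ}
    {f v g w : E → ℝ → ℂ} (hf : Γ.vertexForm l f v = 0) (hg : Γ.vertexForm l g w = 0) :
    ∑ b, (boundaryValue l f b * conj (boundarySlope l w b) -
      boundarySlope l v b * conj (boundaryValue l g b)) = 0 := by
  have := Fintype.ofFinite V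
  rw [← Fintype.sum_fiberwise Γ.vertex]
  exact Finset.sum_eq_zero fun x _ =>
    hΓ.vertex_boundary_eq_zero (congrFun hf x) (congrFun hg x)

/-- Every vertex except the loose one contributes zero, and the loose vertex carries a single edge
end. -/
lemma IsSelfAdjoint.boundary_eq_of_isLooseEdge [Finite V] (hΓ : Γ.IsSelfAdjoint) {e₀ : E}
    (hloose : Γ.IsLooseEdge e₀) {l : E → ℝ} {f v g w : E → ℝ → ℂ}
    (hf : ∀ x ≠ Γ.vertex (e₀, true), Γ.vertexForm l f v x = 0)
    (hg : ∀ x ≠ Γ.vertex (e₀, true), Γ.vertexForm l g w x = 0) :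
    ∑ b, (boundaryValue l f b * conj (boundarySlope l w b) -
      boundarySlope l v b * conj (boundaryValue l g b)) =
    boundaryValue l f (e₀, true) * conj (boundarySlope l w (e₀, true)) -
      boundarySlope l v (e₀, true) * conj (boundaryValue l g (e₀, true)) := by
  have := Fintype.ofFinite V
  rw [← Fintype.sum_fiberwise Γ.vertex, Fintype.sum_eq_single (Γ.vertex (e₀, true))
    fun x hx => hΓ.vertex_boundary_eq_zero (hf x hx) (hg x hx)]
  rw [Fintype.sum_eq_single (⟨(e₀, true), rfl⟩ : Γ.EndsAt (Γ.vertex (e₀, true)))]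
  rintro ⟨b, hb⟩ hne
  exact absurd (Subtype.ext (hloose b hb)) hne

/-- The value at the far end of a loose edge vanishes under a Dirichlet condition there. -/
lemma IsDirichletAt.boundaryValue_eq_zero {e₀ : E} (hDir : Γ.IsDirichletAt (Γ.vertex (e₀, true)))
    {l : E → ℝ} {f v : E → ℝ → ℂ} (hf : Γ.vertexForm l f v (Γ.vertex (e₀, true)) = 0) :
    f e₀ (l e₀) = 0 :=
  congrFun ((hDir _ _).1 hf) ⟨(e₀, true), rfl⟩

/-- Conditions away from the far end of a loose edge do not see the length of that edge. -/
lemma vertexForm_congr_length {e₀ : E} {l l' : E → ℝ}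
    (hl : ∀ e ≠ e₀, l e = l' e) (f v : E → ℝ → ℂ) {x : V} (hx : x ≠ Γ.vertex (e₀, true)) :
    Γ.vertexForm l f v x = Γ.vertexForm l' f v x := by
  have key : ∀ b : Γ.EndsAt x, boundaryValue l f b.1 = boundaryValue l' f b.1 ∧
      boundarySlope l v b.1 = boundarySlope l' v b.1 := by
    rintro ⟨⟨e, i⟩, hb⟩
    cases i with
    | false => exact ⟨rfl, rfl⟩
    | true =>
      have he : e ≠ e₀ := by
        rintro rfl
        exact hx hb.symm
      simp [boundaryValue, boundarySlope, hl e he]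
  rw [vertexForm, vertexForm]
  congr 2 <;> ext b
  · exact (key b).1
  · exact (key b).2

end QuantumGraph

/-! ### The `L²` pairing -/

namespace QuantumGraph

variable {V E : Type*}

/-- The sesquilinear `L²` pairing of functions on a graph with edge lengths `l`. -/
noncomputable def pairing [Fintype E] (l : E → ℝ) (f g : E → ℝ →ᵇ ℂ) : ℂ :=
  ∑ e, ∫ x in (0 : ℝ)..l e, f e x * conj (g e x)

section Pairing

variable [Fintype E] {l : E → ℝ} {f g : E → ℝ →ᵇ ℂ}

/-- The components live on the whole line, in a space that does not depend on the lengths. This is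
what makes continuity in the lengths meaningful. -/
lemma continuous_pairing {X : Type*} [TopologicalSpace X] {l : X → E → ℝ}
    {f g : X → E → ℝ →ᵇ ℂ} (hl : Continuous l) (hf : Continuous f) (hg : Continuous g) :
    Continuous fun x => pairing (l x) (f x) (g x) := by
  refine continuous_finsetSum _ fun e _ => ?_
  refine intervalIntegral.continuous_parametric_intervalIntegral_of_continuous
    (f := fun q x => f q e x * conj (g q e x)) ?_ ((continuous_apply e).comp hl)
  have h1 : Continuous fun r : X × ℝ => f r.1 e r.2 :=
    (((continuous_apply e).comp hf).comp continuous_fst).eval continuous_snd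
  have h2 : Continuous fun r : X × ℝ => g r.1 e r.2 :=
    (((continuous_apply e).comp hg).comp continuous_fst).eval continuous_snd
  exact h1.mul (Complex.continuous_conj.comp h2)

lemma pairing_conj : conj (pairing l f g) = pairing l g f := by
  rw [pairing, pairing, map_sum]
  refine Finset.sum_congr rfl fun e _ => ?_
  have hi : IntervalIntegrable (fun x => f e x * conj (g e x)) volume 0 (l e) :=
    (Continuous.mul (f e).continuous
      (Complex.continuous_conj.comp (g e).continuous)).intervalIntegrable _ _
  have := Complex.conjCLE.toContinuousLinearMap.intervalIntegral_comp_comm hi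
  refine this.symm.trans (intervalIntegral.integral_congr fun x _ => ?_)
  simp [mul_comm]

lemma pairing_self : pairing l f f = ((∑ e, ∫ x in (0 : ℝ)..l e, ‖f e x‖ ^ 2 : ℝ) : ℂ) := by
  rw [pairing, Complex.ofReal_sum]
  refine Finset.sum_congr rfl fun e _ => ?_
  rw [← intervalIntegral.integral_ofReal]
  refine intervalIntegral.integral_congr fun x _ => ?_
  simp [Complex.mul_conj, Complex.normSq_eq_norm_sq]

lemma sum_integral_norm_sq_pos (hl : ∀ e, 0 < l e) {e : E} {x : ℝ} (hx : x ∈ Icc 0 (l e))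
    (hfx : f e x ≠ 0) : 0 < ∑ e, ∫ x in (0 : ℝ)..l e, ‖f e x‖ ^ 2 := by
  refine Finset.sum_pos' (fun e _ => intervalIntegral.integral_nonneg (hl e).le
    fun x _ => by positivity) ⟨e, Finset.mem_univ _, ?_⟩
  refine intervalIntegral.integral_pos (hl e) ?_ (fun x _ => by positivity) ⟨x, hx, ?_⟩
  · exact (by fun_prop : Continuous fun x => ‖f e x‖ ^ 2).continuousOn
  · positivity

lemma pairing_congr_left {f' : E → ℝ →ᵇ ℂ} (hl : ∀ e, 0 ≤ l e)
    (h : ∀ e, ∀ x ∈ Icc 0 (l e), f e x = f' e x) : pairing l f g = pairing l f' g := by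
  refine Finset.sum_congr rfl fun e _ => intervalIntegral.integral_congr fun x hx => ?_
  rw [uIcc_of_le (hl e)] at hx
  simp only [h e x hx]

lemma pairing_smul_left (c : ℂ) : pairing l (c • f) g = c * pairing l f g := by
  rw [pairing, pairing, Finset.mul_sum]
  refine Finset.sum_congr rfl fun e _ => ?_
  rw [← intervalIntegral.integral_const_mul]
  refine intervalIntegral.integral_congr fun x _ => ?_
  simp [mul_assoc]

lemma pairing_add_left (f' : E → ℝ →ᵇ ℂ) :
    pairing l (f + f') g = pairing l f g + pairing l f' g := by
  rw [pairing, pairing, pairing, ← Finset.sum_add_distrib]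
  refine Finset.sum_congr rfl fun e _ => ?_
  have hi : ∀ f : ℝ →ᵇ ℂ, IntervalIntegrable (fun x => f x * conj (g e x)) volume 0 (l e) :=
    fun f => (Continuous.mul f.continuous
      (Complex.continuous_conj.comp (g e).continuous)).intervalIntegrable _ _
  rw [← intervalIntegral.integral_add (hi _) (hi _)]
  refine intervalIntegral.integral_congr fun x _ => ?_
  simp [add_mul]

lemma exists_ne_zero_of_pairing_ne_zero (hl : ∀ e, 0 ≤ l e) (h : pairing l f g ≠ 0) :
    ∃ e, ∃ x ∈ Icc 0 (l e), f e x ≠ 0 := by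
  by_contra! hcon
  apply h
  rw [pairing_congr_left hl (f' := 0) (fun e x hx => by simp [hcon e x hx])]
  simp [pairing]

end Pairing

/-! ### Solutions on all edges and Green's identity -/

/-- Initial values and initial slopes on all edges, and the coefficient of the source term. -/
abbrev Coeff (E : Type*) : Type _ := (E → ℂ) × (E → ℂ) × ℂ

/-- The restriction of the coefficients to one edge. -/
noncomputable def edgeCoeff [Fintype E] (e : E) : Coeff E →L[ℂ] ℂ × ℂ × ℂ :=
  ((ContinuousLinearMap.proj e).comp (ContinuousLinearMap.fst ℂ (E → ℂ) ((E → ℂ) × ℂ))).prod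
    ((((ContinuousLinearMap.proj e).comp (ContinuousLinearMap.fst ℂ (E → ℂ) ℂ)).comp
      (ContinuousLinearMap.snd ℂ (E → ℂ) ((E → ℂ) × ℂ))).prod
    ((ContinuousLinearMap.snd ℂ (E → ℂ) ℂ).comp
      (ContinuousLinearMap.snd ℂ (E → ℂ) ((E → ℂ) × ℂ))))

lemma edgeCoeff_apply [Fintype E] (e : E) (z : Coeff E) :
    edgeCoeff e z = (z.1 e, z.2.1 e, z.2.2) := rfl

section Solutions

variable [Fintype E] {w : E → ℝ → ℂ} (hw : ∀ e, Integrable (w e)) (R : ℝ) (p : E → ℝ →ᵇ ℂ)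

/-- The solution of `u'' = (w - lam) u + τ p` on all edges with given initial data. -/
noncomputable def graphSol (lam : ℝ) (z : Coeff E) (e : E) : ℝ →ᵇ ℂ :=
  Volterra.sol (hw e) R (p e) lam (edgeCoeff e z)

/-- The derivative of `graphSol`. -/
noncomputable def graphSlope (lam : ℝ) (z : Coeff E) (e : E) : ℝ →ᵇ ℂ :=
  Volterra.slope (hw e) R (p e) lam (edgeCoeff e z)

lemma graphSol_add (lam : ℝ) (z z' : Coeff E) :
    graphSol hw R p lam (z + z') = graphSol hw R p lam z + graphSol hw R p lam z' := by
  ext1 e; simp [graphSol]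

lemma graphSol_smul (lam : ℝ) (c : ℂ) (z : Coeff E) :
    graphSol hw R p lam (c • z) = c • graphSol hw R p lam z := by
  ext1 e; simp [graphSol]

lemma graphSlope_add (lam : ℝ) (z z' : Coeff E) :
    graphSlope hw R p lam (z + z') = graphSlope hw R p lam z + graphSlope hw R p lam z' := by
  ext1 e; simp [graphSlope]

lemma graphSlope_smul (lam : ℝ) (c : ℂ) (z : Coeff E) :
    graphSlope hw R p lam (c • z) = c • graphSlope hw R p lam z := by
  ext1 e; simp [graphSlope]

/-- Avoids a circularity: `p` is built as a solution with source `0`, and with `τ = 0` it is also a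
solution with source `p`. -/
lemma graphSol_congr_source (p' : E → ℝ →ᵇ ℂ) (lam : ℝ) {z : Coeff E} (hz : z.2.2 = 0) :
    graphSol hw R p lam z = graphSol hw R p' lam z := by
  ext1 e; simp [graphSol, Volterra.sol, Volterra.slopeDatum, edgeCoeff_apply, hz]

lemma graphSlope_congr_source (p' : E → ℝ →ᵇ ℂ) (lam : ℝ) {z : Coeff E} (hz : z.2.2 = 0) :
    graphSlope hw R p lam z = graphSlope hw R p' lam z := by
  ext1 e; simp [graphSlope, Volterra.slope, Volterra.sol, Volterra.slopeDatum, edgeCoeff_apply, hz]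

variable {R}

lemma continuousAt_graphSol {X : Type*} [TopologicalSpace X] (hR : 0 ≤ R) {lam : X → ℝ}
    {z : X → Coeff E} {x : X} (hlam : ContinuousAt lam x) (hz : ContinuousAt z x) :
    ContinuousAt (fun x => graphSol hw R p (lam x) (z x)) x := by
  refine continuousAt_pi.2 fun e => ?_
  exact ((Volterra.continuous_sol (hw e) (p e) hR).continuousAt.comp hlam).clm_apply
    ((edgeCoeff e).continuous.continuousAt.comp hz)

lemma continuousAt_graphSlope {X : Type*} [TopologicalSpace X] (hR : 0 ≤ R) {lam : X → ℝ}
    {z : X → Coeff E} {x : X} (hlam : ContinuousAt lam x) (hz : ContinuousAt z x) :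
    ContinuousAt (fun x => graphSlope hw R p (lam x) (z x)) x := by
  refine continuousAt_pi.2 fun e => ?_
  exact ((Volterra.continuous_slope (hw e) (p e) hR).continuousAt.comp hlam).clm_apply
    ((edgeCoeff e).continuous.continuousAt.comp hz)

variable {p}

/-- Green's identity on the graph. -/
lemma graph_green (hreal : ∀ e x, conj (w e x) = w e x) {l : E → ℝ} (hl : ∀ e, 0 ≤ l e)
    (hlR : ∀ e, l e ≤ R) (lam mu : ℝ) (z z' : Coeff E) :
    ((mu : ℂ) - lam) * pairing l (graphSol hw R p lam z) (graphSol hw R p mu z')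
      + z.2.2 * pairing l p (graphSol hw R p mu z')
      - conj z'.2.2 * pairing l (graphSol hw R p lam z) p =
    ∑ b, (boundaryValue l (fun e => graphSol hw R p lam z e) b *
        conj (boundarySlope l (fun e => graphSlope hw R p mu z' e) b) -
      boundarySlope l (fun e => graphSlope hw R p lam z e) b *
        conj (boundaryValue l (fun e => graphSol hw R p mu z' e) b)) := by
  rw [← sum_edge_boundary, pairing, pairing, pairing, Finset.mul_sum, Finset.mul_sum,
    Finset.mul_sum, ← Finset.sum_add_distrib, ← Finset.sum_sub_distrib]
  refine Finset.sum_congr rfl fun e _ => ?_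
  refine Eq.trans ?_ (IsPrimitiveOn.green (hl e)
    (Volterra.isPrimitiveOn_sol (hw e) (hl e) (hlR e) lam (edgeCoeff e z))
    (Volterra.isPrimitiveOn_slope (hw e) (hl e) (hlR e) lam (edgeCoeff e z))
    (Volterra.isPrimitiveOn_sol (hw e) (hl e) (hlR e) mu (edgeCoeff e z'))
    (Volterra.isPrimitiveOn_slope (hw e) (hl e) (hlR e) mu (edgeCoeff e z')))
  have hi : ∀ f g : ℝ →ᵇ ℂ, IntervalIntegrable (fun x => f x * conj (g x)) volume 0 (l e) :=
    fun f g => (Continuous.mul f.continuous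
      (Complex.continuous_conj.comp g.continuous)).intervalIntegrable _ _
  rw [← intervalIntegral.integral_const_mul, ← intervalIntegral.integral_const_mul,
    ← intervalIntegral.integral_const_mul,
    ← intervalIntegral.integral_add ((hi _ _).const_mul _) ((hi _ _).const_mul _),
    ← intervalIntegral.integral_sub (((hi _ _).const_mul _).add ((hi _ _).const_mul _))
      ((hi _ _).const_mul _)]
  refine intervalIntegral.integral_congr fun x _ => ?_
  simp only [graphSol, edgeCoeff_apply, map_add, map_mul, map_sub, hreal, Complex.conj_ofReal]
  ring

end Solutions

/-! ### The bordered boundary value problem -/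

section BoundaryValueProblem

variable [Fintype E] [DecidableEq V] (Γ : QuantumGraph V E)

lemma vertexForm_add (l : E → ℝ) (f v f' v' : E → ℝ →ᵇ ℂ) :
    Γ.vertexForm l (fun e => (f + f') e) (fun e => (v + v') e) =
      Γ.vertexForm l (fun e => f e) (fun e => v e) +
      Γ.vertexForm l (fun e => f' e) (fun e => v' e) := by
  have h1 : ∀ b, boundaryValue l (fun e => ⇑((f + f') e)) b =
      boundaryValue l (fun e => f e) b + boundaryValue l (fun e => f' e) b := by
    rintro ⟨e, _ | _⟩ <;> simp [boundaryValue]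
  have h2 : ∀ b, boundarySlope l (fun e => ⇑((v + v') e)) b =
      boundarySlope l (fun e => v e) b + boundarySlope l (fun e => v' e) b := by
    rintro ⟨e, _ | _⟩ <;> simp [boundarySlope]
    ring
  ext1 x
  change Γ.A x *ᵥ (fun b : Γ.EndsAt x => boundaryValue l (fun e => ⇑((f + f') e)) b.1) +
    Γ.B x *ᵥ (fun b : Γ.EndsAt x => boundarySlope l (fun e => ⇑((v + v') e)) b.1) =
    Γ.vertexForm l (fun e => f e) (fun e => v e) x +
      Γ.vertexForm l (fun e => f' e) (fun e => v' e) x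
  rw [vertexForm, vertexForm]
  rw [show (fun b : Γ.EndsAt x => boundaryValue l (fun e => ⇑((f + f') e)) b.1) =
      (fun b : Γ.EndsAt x => boundaryValue l (fun e => f e) b.1) +
        fun b : Γ.EndsAt x => boundaryValue l (fun e => f' e) b.1 from funext fun b => h1 b.1,
    show (fun b : Γ.EndsAt x => boundarySlope l (fun e => ⇑((v + v') e)) b.1) =
      (fun b : Γ.EndsAt x => boundarySlope l (fun e => v e) b.1) +
        fun b : Γ.EndsAt x => boundarySlope l (fun e => v' e) b.1 from funext fun b => h2 b.1,
    Matrix.mulVec_add, Matrix.mulVec_add]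
  abel

lemma vertexForm_smul (l : E → ℝ) (c : ℂ) (f v : E → ℝ →ᵇ ℂ) :
    Γ.vertexForm l (fun e => (c • f) e) (fun e => (c • v) e) =
      c • Γ.vertexForm l (fun e => f e) (fun e => v e) := by
  have h1 : ∀ b, boundaryValue l (fun e => ⇑((c • f) e)) b =
      c * boundaryValue l (fun e => f e) b := by
    rintro ⟨e, _ | _⟩ <;> simp [boundaryValue]
  have h2 : ∀ b, boundarySlope l (fun e => ⇑((c • v) e)) b =
      c * boundarySlope l (fun e => v e) b := by
    rintro ⟨e, _ | _⟩ <;> simp [boundarySlope]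
  ext1 x
  change Γ.A x *ᵥ (fun b : Γ.EndsAt x => boundaryValue l (fun e => ⇑((c • f) e)) b.1) +
    Γ.B x *ᵥ (fun b : Γ.EndsAt x => boundarySlope l (fun e => ⇑((c • v) e)) b.1) =
    c • (Γ.vertexForm l (fun e => f e) (fun e => v e) x)
  rw [vertexForm]
  rw [show (fun b : Γ.EndsAt x => boundaryValue l (fun e => ⇑((c • f) e)) b.1) =
      c • (fun b : Γ.EndsAt x => boundaryValue l (fun e => f e) b.1) from funext fun b => h1 b.1,
    show (fun b : Γ.EndsAt x => boundarySlope l (fun e => ⇑((c • v) e)) b.1) =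
      c • (fun b : Γ.EndsAt x => boundarySlope l (fun e => v e) b.1) from funext fun b => h2 b.1,
    Matrix.mulVec_smul, Matrix.mulVec_smul, smul_add]

lemma continuous_vertexForm {X : Type*} [TopologicalSpace X] {l : X → E → ℝ}
    {f v : X → E → ℝ →ᵇ ℂ} (hl : Continuous l) (hf : Continuous f) (hv : Continuous v) :
    Continuous fun x => Γ.vertexForm (l x) (fun e => f x e) (fun e => v x e) := by
  have key : ∀ {f : X → E → ℝ →ᵇ ℂ} {a : X → ℝ}, Continuous f → Continuous a → ∀ e,
      Continuous fun x => f x e (a x) := fun hf ha e => ((continuous_apply e).comp hf).eval ha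
  refine continuous_pi fun y => ?_
  refine (continuous_const.matrix_mulVec (continuous_pi fun b => ?_)).add
    (continuous_const.matrix_mulVec (continuous_pi fun b => ?_))
  · obtain ⟨⟨e, i⟩, hb⟩ := b
    cases i
    · exact key hf continuous_const e
    · exact key hf ((continuous_apply e).comp hl) e
  · obtain ⟨⟨e, i⟩, hb⟩ := b
    cases i
    · exact key hv continuous_const e
    · exact (key hv ((continuous_apply e).comp hl) e).neg

variable {w : E → ℝ → ℂ} (hw : ∀ e, Integrable (w e)) (R : ℝ) (p : E → ℝ →ᵇ ℂ)

/-- The map sending coefficients to the vertex conditions and the pairing with the source, of the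
corresponding solution. -/
noncomputable def boundaryMap (l : E → ℝ) (lam : ℝ) :
    Coeff E →L[ℂ] (∀ x, Γ.EndsAt x → ℂ) × ℂ :=
  LinearMap.toContinuousLinearMap
    { toFun := fun z => (Γ.vertexForm l (fun e => graphSol hw R p lam z e)
        (fun e => graphSlope hw R p lam z e), pairing l (graphSol hw R p lam z) p)
      map_add' := fun z z' => by
        rw [graphSol_add, graphSlope_add, vertexForm_add, pairing_add_left]; rfl
      map_smul' := fun c z => by
        rw [graphSol_smul, graphSlope_smul, vertexForm_smul, pairing_smul_left]; rfl }

lemma boundaryMap_apply (l : E → ℝ) (lam : ℝ) (z : Coeff E) :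
    Γ.boundaryMap hw R p l lam z = (Γ.vertexForm l (fun e => graphSol hw R p lam z e)
        (fun e => graphSlope hw R p lam z e), pairing l (graphSol hw R p lam z) p) := rfl

variable {R}

lemma continuous_boundaryMap {X : Type*} [TopologicalSpace X] [Fintype V] (hR : 0 ≤ R)
    {l : X → E → ℝ} {lam : X → ℝ} (hl : Continuous l) (hlam : Continuous lam) :
    Continuous fun x => Γ.boundaryMap hw R p (l x) (lam x) := by
  refine continuous_clm_apply.2 fun z => ?_
  have h1 : Continuous fun x => graphSol hw R p (lam x) z := continuous_iff_continuousAt.2 fun _ =>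
    continuousAt_graphSol hw p hR hlam.continuousAt continuousAt_const
  have h2 : Continuous fun x => graphSlope hw R p (lam x) z := continuous_iff_continuousAt.2 fun _ =>
    continuousAt_graphSlope hw p hR hlam.continuousAt continuousAt_const
  exact (Γ.continuous_vertexForm hl h1 h2).prodMk (continuous_pairing hl h1 continuous_const)

/-- Two initial data per edge match one scalar condition per edge end; the source coefficient
matches the normalization. -/
lemma finrank_coeff [Fintype V] : Module.finrank ℂ (Coeff E) =
    Module.finrank ℂ ((∀ x, Γ.EndsAt x → ℂ) × ℂ) := by
  simp only [Module.finrank_prod, Module.finrank_pi_fintype, Module.finrank_self,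
    Finset.sum_const, Finset.card_univ, smul_eq_mul, mul_one]
  have h1 := Fintype.sum_fiberwise Γ.vertex (fun _ => (1 : ℕ))
  simp only [Finset.sum_const, Finset.card_univ, smul_eq_mul, mul_one, Fintype.card_prod,
    Fintype.card_bool] at h1
  rw [h1]
  omega

end BoundaryValueProblem

end QuantumGraph

lemma IsPrimitiveOn.sub {L : ℝ} {f g h k : ℝ → ℂ} (hf : IsPrimitiveOn L f h)
    (hg : IsPrimitiveOn L g k) : IsPrimitiveOn L (fun x => f x - g x) (fun x => h x - k x) where
  intervalIntegrable := hf.intervalIntegrable.sub hg.intervalIntegrable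
  eq_add_integral x hx := by
    rw [hf.eq_add_integral x hx, hg.eq_add_integral x hx, intervalIntegral.integral_sub
      (hf.mono_right hx).intervalIntegrable (hg.mono_right hx).intervalIntegrable]
    ring

/-! ### Eigenspaces in terms of initial data -/

namespace QuantumGraph

variable {V E : Type*} {Γ : QuantumGraph V E}

lemma boundaryValue_length (f : E → ℝ → ℂ) :
    boundaryValue Γ.length f = Γ.endValue f := by
  ext ⟨e, _ | _⟩ <;> rfl

lemma boundarySlope_length (hpos : ∀ e, 0 < Γ.length e) {f v : E → ℝ → ℂ}
    (hv : ∀ e, ∀ x ∈ Icc 0 (Γ.length e), Γ.edgeDeriv f e x = v e x) :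
    boundarySlope Γ.length v = Γ.endDeriv f := by
  ext ⟨e, _ | _⟩
  · exact (hv e 0 ⟨le_rfl, (hpos e).le⟩).symm
  · exact congrArg Neg.neg (hv e _ ⟨(hpos e).le, le_rfl⟩).symm

lemma edgeDeriv_congr {f g : E → ℝ → ℂ} {e : E}
    (h : ∀ x ∈ Icc 0 (Γ.length e), f e x = g e x) {x : ℝ} (hx : x ∈ Icc 0 (Γ.length e)) :
    Γ.edgeDeriv f e x = Γ.edgeDeriv g e x :=
  derivWithin_congr h (h x hx)

variable [Fintype E] {w : E → ℝ → ℂ} (hw : ∀ e, Integrable (w e)) {R : ℝ} (p : E → ℝ →ᵇ ℂ)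
  {lam : ℝ}

lemma edgeDeriv_graphSol (hpos : ∀ e, 0 < Γ.length e) (hR : ∀ e, Γ.length e ≤ R) (z : Coeff E)
    (e : E) {x : ℝ} (hx : x ∈ Icc 0 (Γ.length e)) :
    Γ.edgeDeriv (fun e => graphSol hw R p lam z e) e x = graphSlope hw R p lam z e x :=
  (Volterra.isPrimitiveOn_sol (hw e) (hpos e).le (hR e) lam _).derivWithin_eq (hpos e)
    (Volterra.isPrimitiveOn_slope (hw e) (hpos e).le (hR e) lam _) hx

variable [DecidableEq V]

lemma vertexForm_length (hpos : ∀ e, 0 < Γ.length e) {f v : E → ℝ → ℂ}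
    (hv : ∀ e, ∀ x ∈ Icc 0 (Γ.length e), Γ.edgeDeriv f e x = v e x) (x : V) :
    Γ.vertexForm Γ.length f v x = Γ.A x *ᵥ Γ.vertexValue f x + Γ.B x *ᵥ Γ.vertexDeriv f x := by
  rw [vertexForm, boundaryValue_length, boundarySlope_length hpos hv]
  rfl

/-- Elements of the eigenspace are solutions satisfying the vertex conditions. -/
lemma MemEigenspace.exists_coeff (hpos : ∀ e, 0 < Γ.length e) (hR : ∀ e, Γ.length e ≤ R)
    (hwq : ∀ e, ∀ x ∈ Ioo 0 (Γ.length e), w e x = Γ.potential e x) {f : E → ℝ → ℂ}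
    (hf : Γ.MemEigenspace lam f) :
    ∃ z : Coeff E, z.2.2 = 0 ∧ Γ.vertexForm Γ.length (fun e => graphSol hw R p lam z e)
        (fun e => graphSlope hw R p lam z e) = 0 ∧
      ∀ e, ∀ x ∈ Icc 0 (Γ.length e), f e x = graphSol hw R p lam z e x ∧
        Γ.edgeDeriv f e x = graphSlope hw R p lam z e x := by
  obtain ⟨g, ⟨hH2, hvert⟩, hode⟩ := hf
  set z : Coeff E := (fun e => f e 0, fun e => Γ.edgeDeriv f e 0, 0) with hz
  have hsol : ∀ e, ∀ x ∈ Icc 0 (Γ.length e), f e x = graphSol hw R p lam z e x := by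
    intro e x hx
    have hl := (hpos e).le
    have h1 := ((hH2 e).isPrimitiveOn hl).sub
      (Volterra.isPrimitiveOn_sol (hw e) (p := p e) hl (hR e) lam (edgeCoeff e z))
    have h2 := ((hH2 e).isPrimitiveOn_derivWithin hl).sub
      (Volterra.isPrimitiveOn_slope (hw e) (p := p e) hl (hR e) lam (edgeCoeff e z))
    have hRe := hl.trans (hR e)
    -- The difference of `f` and the solution with the same initial data solves the homogeneous
    -- equation with zero data.
    have h3 := h1.eq_zero_of_linear hl h2 (w := fun x => w e x - lam)
      ((hw e).intervalIntegrable.sub intervalIntegrable_const) ?_ ?_ ?_ x hx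
    · exact sub_eq_zero.1 h3
    · filter_upwards [hode e, ae_restrict_mem measurableSet_Ioo] with x hx hxm
      have hg : g e x = (w e x - lam) * f e x := by
        rw [hwq e x hxm]
        linear_combination -hx
      rw [hg, edgeCoeff_apply]
      simp only [hz]
      ring
    · rw [Volterra.sol_zero _ _ hRe]
      simp [edgeCoeff_apply, hz]
    · rw [Volterra.slope_zero]
      simp [edgeCoeff_apply, hz, edgeDeriv]
  have hslope : ∀ e, ∀ x ∈ Icc 0 (Γ.length e),
      Γ.edgeDeriv f e x = graphSlope hw R p lam z e x := fun e x hx => by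
    rw [← edgeDeriv_graphSol hw p hpos hR z e hx]
    exact edgeDeriv_congr (hsol e) hx
  refine ⟨z, rfl, ?_, fun e x hx => ⟨hsol e x hx, hslope e x hx⟩⟩
  ext1 x
  rw [Pi.zero_apply, ← hvert x, ← vertexForm_length hpos hslope x, vertexForm, vertexForm]
  congr 3
  ext ⟨⟨e, i⟩, hb⟩
  cases i
  · exact (hsol e 0 ⟨le_rfl, (hpos e).le⟩).symm
  · exact (hsol e _ ⟨(hpos e).le, le_rfl⟩).symm

lemma memEigenspace_graphSol (hΓ : Γ.IsSelfAdjoint) (hR : ∀ e, Γ.length e ≤ R)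
    (hwq : ∀ e, ∀ x ∈ Ioo 0 (Γ.length e), w e x = Γ.potential e x) {z : Coeff E}
    (hz : z.2.2 = 0) (hvert : Γ.vertexForm Γ.length (fun e => graphSol hw R p lam z e)
        (fun e => graphSlope hw R p lam z e) = 0) :
    Γ.MemEigenspace lam (fun e => graphSol hw R p lam z e) := by
  have hpos := hΓ.length_pos
  refine ⟨fun e x => (w e x - lam) * graphSol hw R p lam z e x, ⟨fun e => ?_, fun x => ?_⟩,
    fun e => ?_⟩
  · have hs := Volterra.isPrimitiveOn_slope (hw e) (p := p e) (hpos e).le (hR e) lam (edgeCoeff e z)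
    rw [show (edgeCoeff e z).2.2 = 0 from hz] at hs
    simp only [zero_mul, add_zero] at hs
    refine (Volterra.isPrimitiveOn_sol (hw e) (hpos e).le (hR e) lam _).memSobolevH2 (hpos e) hs ?_
    have h1 : MemLp (w e) 2 (volume.restrict (Ioo 0 (Γ.length e))) := by
      refine MemLp.ae_eq ?_ (MemLp.ofReal (K := ℂ) (hΓ.potential_memLp e))
      filter_upwards [ae_restrict_mem measurableSet_Ioo] with x hx
      exact (hwq e x hx).symm
    have h2 : MemLp (fun x => w e x - lam) 2 (volume.restrict (Ioo 0 (Γ.length e))) :=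
      h1.sub (memLp_const _)
    have h3 : MemLp (fun x => graphSol hw R p lam z e x) ⊤
        (volume.restrict (Ioo 0 (Γ.length e))) :=
      memLp_top_of_bound (graphSol hw R p lam z e).continuous.aestronglyMeasurable _
        (Eventually.of_forall (graphSol hw R p lam z e).norm_coe_le_norm)
    exact h3.mul h2
  · rw [← vertexForm_length hpos (fun e x hx => edgeDeriv_graphSol hw p hpos hR z e hx) x, hvert]
    rfl
  · filter_upwards [ae_restrict_mem measurableSet_Ioo] with x hx
    rw [hwq e x hx]
    ring

lemma IsSelfAdjoint.withLength [DecidableEq E] (hΓ : Γ.IsSelfAdjoint) {e₀ : E} {b s : ℝ}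
    (hpot : MemLp (Γ.potential e₀) 2 (volume.restrict (Ioo 0 b))) (hs : 0 < s) (hsb : s ≤ b) :
    (Γ.withLength e₀ s).IsSelfAdjoint where
  length_pos e := by
    by_cases he : e = e₀
    · subst he; simpa [QuantumGraph.withLength] using hs
    · simpa [QuantumGraph.withLength, he] using hΓ.length_pos e
  potential_memLp e := by
    by_cases he : e = e₀
    · subst he
      simp only [QuantumGraph.withLength, Function.update_self]
      exact hpot.mono_measure (Measure.restrict_mono (Ioo_subset_Ioo_right hsb) le_rfl)
    · simpa [QuantumGraph.withLength, he] using hΓ.potential_memLp e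
  rank_eq := hΓ.rank_eq
  isHermitian := hΓ.isHermitian

end QuantumGraph

/-! ### Inverses, zero branches and differentiation -/

/-- Injectivity of a map between spaces of the same finite dimension is an open condition, and the
inverse depends continuously on the map. -/
lemma ContinuousLinearMap.eventually_bijective_and_continuousAt_inverse {X F G : Type*}
    [TopologicalSpace X] [NormedAddCommGroup F] [NormedSpace ℂ F] [NormedAddCommGroup G]
    [NormedSpace ℂ G] [FiniteDimensional ℂ F] [FiniteDimensional ℂ G]
    (hfin : Module.finrank ℂ F = Module.finrank ℂ G) {M : X → F →L[ℂ] G} (hM : Continuous M)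
    {x₀ : X} (hinj : Function.Injective (M x₀)) (y : G) :
    ∀ᶠ x in 𝓝 x₀, Function.Injective (M x) ∧ M x ((M x).inverse y) = y ∧
      ContinuousAt (fun x => (M x).inverse y) x := by
  have : CompleteSpace F := FiniteDimensional.complete ℂ F
  have : CompleteSpace G := FiniteDimensional.complete ℂ G
  let e₀ : F ≃L[ℂ] G :=
    (LinearEquiv.ofInjectiveOfFinrankEq (M x₀ : F →ₗ[ℂ] G) hinj hfin).toContinuousLinearEquiv
  have he₀ : (e₀ : F →L[ℂ] G) = M x₀ := by
    ext x; rfl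
  have h1 := e₀.nhds
  rw [he₀] at h1
  filter_upwards [hM.continuousAt.preimage_mem_nhds h1] with x hx
  obtain ⟨e, he⟩ := hx
  refine ⟨?_, ?_, ?_⟩
  · rw [← he]; exact e.injective
  · rw [← he, ContinuousLinearMap.inverse_equiv]; simp
  · have h2 : ContinuousAt (ContinuousLinearMap.inverse : (F →L[ℂ] G) → G →L[ℂ] F) (M x) := by
      rw [← he]; exact (contDiffAt_map_inverse (n := 0) e).continuousAt
    have h3 : ContinuousAt (fun x => (M x).inverse) x :=
      ContinuousAt.comp (f := M) h2 hM.continuousAt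
    exact h3.clm_apply continuousAt_const

/-- A continuous function on the plane that is linear with positive slope on a vertical line has
zeros near that line. -/
lemma exists_zero_branch {T : ℝ × ℝ → ℝ} {s₀ lam₀ k : ℝ} (hk : 0 < k)
    (hT : ∀ᶠ q in 𝓝 (s₀, lam₀), ContinuousAt T q)
    (hT₀ : ∀ᶠ lam in 𝓝 lam₀, T (s₀, lam) = k * (lam - lam₀)) {Q : ℝ × ℝ → ℝ × ℝ → Prop}
    (hQ : ∀ᶠ r in 𝓝 ((s₀, lam₀), (s₀, lam₀)), Q r.1 r.2) :
    ∃ ε > 0, ∃ δ > 0, ∃ lam : ℝ → ℝ, lam s₀ = lam₀ ∧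
      (∀ s, |s - s₀| < ε → |lam s - lam₀| < δ ∧ T (s, lam s) = 0) ∧
      ∀ s t x y, |s - s₀| < ε → |t - s₀| < ε → |x - lam₀| < δ → |y - lam₀| < δ →
        Q (s, x) (t, y) := by
  obtain ⟨r₁, hr₁, h₁⟩ := Metric.eventually_nhds_iff.1 hT
  obtain ⟨r₂, hr₂, h₂⟩ := Metric.eventually_nhds_iff.1 hT₀
  obtain ⟨r₃, hr₃, h₃⟩ := Metric.eventually_nhds_iff.1 hQ
  -- Strictly below all three radii, so that the closed interval with ends `lam₀ ± δ` is still
  -- covered; the sign of `T` is read off at these ends.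
  obtain ⟨δ, hδ, hδ'⟩ := exists_between (lt_min (lt_min hr₁ hr₂) hr₃)
  have hδ₁ : δ < r₁ := hδ'.trans_le ((min_le_left _ _).trans (min_le_left _ _))
  have hδ₂ : δ < r₂ := hδ'.trans_le ((min_le_left _ _).trans (min_le_right _ _))
  have hδ₃ : δ < r₃ := hδ'.trans_le (min_le_right _ _)
  have hcont : ∀ s x, |s - s₀| ≤ δ → |x - lam₀| ≤ δ → ContinuousAt T (s, x) := fun s x hs hx => by
    refine h₁ ?_
    rw [Prod.dist_eq, Real.dist_eq, Real.dist_eq]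
    exact (max_le hs hx).trans_lt hδ₁
  have hcs : ∀ x, |x - lam₀| ≤ δ → ContinuousAt (fun s => T (s, x)) s₀ := fun x hx =>
    ContinuousAt.comp (f := fun s => (s, x)) (hcont s₀ x (by simpa using hδ.le) hx)
      (by fun_prop)
  have hlin : ∀ x, |x - lam₀| ≤ δ → T (s₀, x) = k * (x - lam₀) := fun x hx =>
    h₂ (by rw [Real.dist_eq]; exact hx.trans_lt hδ₂)
  have hplus : ∀ᶠ s in 𝓝 s₀, 0 < T (s, lam₀ + δ) := by
    have habs : |lam₀ + δ - lam₀| ≤ δ := by rw [add_sub_cancel_left, abs_of_pos hδ]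
    refine (hcs _ habs).eventually (lt_mem_nhds ?_)
    change 0 < T (s₀, lam₀ + δ)
    rw [hlin _ habs, add_sub_cancel_left]
    positivity
  have hminus : ∀ᶠ s in 𝓝 s₀, T (s, lam₀ - δ) < 0 := by
    have habs : |lam₀ - δ - lam₀| ≤ δ := by rw [sub_sub_cancel_left, abs_neg, abs_of_pos hδ]
    refine (hcs _ habs).eventually (gt_mem_nhds ?_)
    change T (s₀, lam₀ - δ) < 0
    rw [hlin _ habs, sub_sub_cancel_left, mul_neg, neg_neg_iff_pos]
    positivity
  obtain ⟨r₄, hr₄, h₄⟩ := Metric.eventually_nhds_iff.1 (hplus.and hminus)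
  have hε : 0 < min r₄ δ := lt_min hr₄ hδ
  have hex : ∀ s, |s - s₀| < min r₄ δ → ∃ x, |x - lam₀| < δ ∧ T (s, x) = 0 := by
    intro s hs
    have h5 := h₄ (y := s) (by rw [Real.dist_eq]; exact hs.trans_le (min_le_left _ _))
    have h6 : ContinuousOn (fun x => T (s, x)) (Icc (lam₀ - δ) (lam₀ + δ)) := by
      intro x hx
      refine ContinuousAt.continuousWithinAt (ContinuousAt.comp (f := fun x => (s, x))
        (hcont s x (hs.le.trans (min_le_right _ _)) ?_) (by fun_prop))
      rw [abs_le]; constructor <;> linarith [hx.1, hx.2]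
    obtain ⟨x, hx, hx0⟩ := intermediate_value_Ioo (by linarith) h6
      (show (0 : ℝ) ∈ Ioo (T (s, lam₀ - δ)) (T (s, lam₀ + δ)) from ⟨h5.2, h5.1⟩)
    exact ⟨x, by rw [abs_lt]; constructor <;> linarith [hx.1, hx.2], hx0⟩
  -- An arbitrary choice of zeros: no continuity of `lam` is available from here.
  choose! lam hlam using hex
  refine ⟨min r₄ δ, hε, δ, hδ, lam, ?_, hlam, ?_⟩
  · obtain ⟨h5, h6⟩ := hlam s₀ (by simpa using hε)
    rw [hlin _ h5.le] at h6
    have := (mul_eq_zero.1 h6).resolve_left hk.ne'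
    linarith
  · intro s t x y hs ht hx hy
    refine h₃ (y := ((s, x), (t, y))) ?_
    simp only [Prod.dist_eq, Real.dist_eq]
    have hs' := hs.trans_le (min_le_right _ _)
    have ht' := ht.trans_le (min_le_right _ _)
    refine max_lt (max_lt ?_ ?_) (max_lt ?_ ?_) <;> linarith

/-- Differentiation of a function from a first order expansion whose coefficients depend
continuously on the function itself. -/
lemma hasDerivAt_of_quotient {lam : ℝ → ℝ} {s C c P : ℝ} {v : ℝ → ℝ →ᵇ ℂ} {G : ℝ → ℂ}
    (hc : 0 < c) (hGc : ∀ᶠ t in 𝓝 s, c ≤ ‖G t‖) (hvC : ∀ᶠ t in 𝓝 s, ‖v t‖ ≤ C)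
    (hv : ContinuousAt lam s → ContinuousAt v s) (hG : ContinuousAt lam s → ContinuousAt G s)
    (hGs : G s = P)
    (h : ∀ᶠ t in 𝓝 s, ((lam t : ℂ) - lam s) * G t = -(∫ x in s..t, v t x) * conj (v s s)) :
    HasDerivAt lam (-(‖v s s‖ ^ 2 / P)) s := by
  -- Taking norms in the expansion gives `c |lam t - lam s| ≤ C |t - s| ‖v s s‖`, using only bounds
  -- uniform in `t`. Only then do the continuity hypotheses on `v` and `G` become usable.
  have hlam : ContinuousAt lam s := by
    rw [ContinuousAt, tendsto_iff_norm_sub_tendsto_zero]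
    have h1 : Tendsto (fun t => C * |t - s| * ‖v s s‖ / c) (𝓝 s) (𝓝 0) := by
      have : Continuous fun t => C * |t - s| * ‖v s s‖ / c := by fun_prop
      simpa using this.tendsto s
    refine squeeze_zero' (Eventually.of_forall fun _ => norm_nonneg _) ?_ h1
    filter_upwards [hGc, hvC, h] with t h2 h3 h4
    rw [le_div_iff₀ hc]
    have h5 := congrArg norm h4
    rw [norm_mul, norm_mul, norm_neg, RCLike.norm_conj, ← Complex.ofReal_sub,
      Complex.norm_real] at h5
    have h6 : ‖∫ x in s..t, v t x‖ ≤ C * |t - s| :=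
      intervalIntegral.norm_integral_le_of_norm_le_const fun x _ =>
        ((v t).norm_coe_le_norm x).trans h3
    calc ‖lam t - lam s‖ * c ≤ ‖lam t - lam s‖ * ‖G t‖ := by gcongr
      _ = ‖∫ x in s..t, v t x‖ * ‖v s s‖ := h5
      _ ≤ C * |t - s| * ‖v s s‖ := by gcongr
  have hG0 : G s ≠ 0 := by
    rw [← norm_pos_iff]
    exact hc.trans_le hGc.self_of_nhds
  -- The mean of `v t` over the segment from `s` to `t`, rescaled to `[0, 1]` so that it is defined
  -- and continuous at `t = s` as well.
  let A : ℝ → ℂ := fun t => ∫ θ in (0 : ℝ)..1, v t (s + (t - s) * θ)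
  have hA : ContinuousAt A s := by
    have h1 : Continuous fun r : (ℝ →ᵇ ℂ) × ℝ => ∫ θ in (0 : ℝ)..1, r.1 (s + (r.2 - s) * θ) := by
      refine intervalIntegral.continuous_parametric_intervalIntegral_of_continuous'
        (f := fun (r : (ℝ →ᵇ ℂ) × ℝ) θ => r.1 (s + (r.2 - s) * θ)) ?_ 0 1
      exact (continuous_fst.comp continuous_fst).eval (by fun_prop)
    exact ContinuousAt.comp (f := fun t => (v t, t)) h1.continuousAt
      ((hv hlam).prodMk continuousAt_id)
  have hAs : A s = v s s := by simp [A]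
  have hint : ∀ t, ∫ x in s..t, v t x = ((t - s : ℝ) : ℂ) * A t := by
    intro t
    have := intervalIntegral.smul_integral_comp_add_mul (a := 0) (b := 1) (fun x => v t x) (t - s) s
    simp only [mul_zero, add_zero, mul_one, add_sub_cancel] at this
    rw [← this, Complex.real_smul]
  rw [hasDerivAt_iff_tendsto_slope]
  -- The quotient is formed in `ℂ`; real parts are taken because it agrees with the real difference
  -- quotient of `lam` for `t ≠ s`.
  have hlim : Tendsto (fun t => (-(A t * conj (v s s)) / G t).re) (𝓝[≠] s)
      (𝓝 (-(‖v s s‖ ^ 2 / P))) := by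
    have h1 : ContinuousAt (fun t => (-(A t * conj (v s s)) / G t).re) s :=
      Complex.continuous_re.continuousAt.comp
        (((hA.mul continuousAt_const).neg).div (hG hlam) hG0)
    have h2 : (-(A s * conj (v s s)) / G s).re = -(‖v s s‖ ^ 2 / P) := by
      rw [hAs, hGs, Complex.mul_conj, Complex.normSq_eq_norm_sq, ← Complex.ofReal_neg,
        ← Complex.ofReal_div, Complex.ofReal_re, neg_div]
    rw [← h2]
    exact h1.tendsto.mono_left nhdsWithin_le_nhds
  refine hlim.congr' ?_
  filter_upwards [nhdsWithin_le_nhds hGc, nhdsWithin_le_nhds h, self_mem_nhdsWithin]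
    with t h1 h2 h3
  have hGt : G t ≠ 0 := by
    rw [← norm_pos_iff]
    exact hc.trans_le h1
  have hts : ((t - s : ℝ) : ℂ) ≠ 0 := by
    rw [Complex.ofReal_ne_zero]
    exact sub_ne_zero.2 h3
  have h4 : -(A t * conj (v s s)) / G t = ((slope lam s t : ℝ) : ℂ) := by
    rw [slope_def_field, Complex.ofReal_div, Complex.ofReal_sub (lam t), div_eq_div_iff hGt hts, h2,
      hint]
    ring
  rw [h4, Complex.ofReal_re]

/-! ### Consequences of Green's identity -/

namespace QuantumGraph

variable {V E : Type*} [Finite V] [Fintype E] [DecidableEq V] {Γ : QuantumGraph V E}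
  {w : E → ℝ → ℂ} (hw : ∀ e, Integrable (w e)) {R : ℝ} {p : E → ℝ →ᵇ ℂ}

/-- Green's identity for two functions satisfying all vertex conditions. -/
lemma IsSelfAdjoint.green_eq_zero (hΓ : Γ.IsSelfAdjoint)
    (hreal : ∀ e x, conj (w e x) = w e x) {l : E → ℝ} (hl : ∀ e, 0 ≤ l e)
    (hlR : ∀ e, l e ≤ R) {lam mu : ℝ} {z z' : Coeff E}
    (hz : Γ.vertexForm l (fun e => graphSol hw R p lam z e)
      (fun e => graphSlope hw R p lam z e) = 0)
    (hz' : Γ.vertexForm l (fun e => graphSol hw R p mu z' e)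
      (fun e => graphSlope hw R p mu z' e) = 0) :
    ((mu : ℂ) - lam) * pairing l (graphSol hw R p lam z) (graphSol hw R p mu z')
      + z.2.2 * pairing l p (graphSol hw R p mu z')
      - conj z'.2.2 * pairing l (graphSol hw R p lam z) p = 0 := by
  rw [graph_green hw hreal hl hlR, hΓ.boundary_eq_zero hz hz']

/-- Green's identity for two solutions satisfying a Dirichlet condition at different points of a
loose edge. -/
lemma IsSelfAdjoint.green_of_isLooseEdge (hΓ : Γ.IsSelfAdjoint)
    (hreal : ∀ e x, conj (w e x) = w e x) {e₀ : E} (hloose : Γ.IsLooseEdge e₀)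
    (hDir : Γ.IsDirichletAt (Γ.vertex (e₀, true))) {l l' : E → ℝ} (hl : ∀ e, 0 ≤ l e)
    (hlR : ∀ e, l e ≤ R) (hl' : 0 ≤ l' e₀) (hlR' : l' e₀ ≤ R) (hll' : ∀ e ≠ e₀, l' e = l e)
    {lam mu : ℝ} {z z' : Coeff E}
    (hz : Γ.vertexForm l' (fun e => graphSol hw R p lam z e)
      (fun e => graphSlope hw R p lam z e) = 0)
    (hz' : Γ.vertexForm l (fun e => graphSol hw R p mu z' e)
      (fun e => graphSlope hw R p mu z' e) = 0) (hz0 : z.2.2 = 0) (hz0' : z'.2.2 = 0) :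
    ((lam : ℂ) - mu) * pairing l (graphSol hw R p lam z) (graphSol hw R p mu z') =
      -(∫ x in (l e₀)..(l' e₀), graphSlope hw R p lam z e₀ x) *
        conj (graphSlope hw R p mu z' e₀ (l e₀)) := by
  have h1 := graph_green hw hreal hl hlR lam mu z z' (p := p)
  rw [hΓ.boundary_eq_of_isLooseEdge hloose
    (fun x hx => by rw [← vertexForm_congr_length hll' _ _ hx, hz]; rfl)
    (fun x _ => congrFun hz' x), hz0, hz0'] at h1
  have h2 : graphSol hw R p mu z' e₀ (l e₀) = 0 := hDir.boundaryValue_eq_zero (congrFun hz' _)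
  have h3 : graphSol hw R p lam z e₀ (l' e₀) = 0 := hDir.boundaryValue_eq_zero (congrFun hz _)
  have h4 : ∀ x, 0 ≤ x → x ≤ R → graphSol hw R p lam z e₀ x =
      graphSol hw R p lam z e₀ 0 + ∫ t in (0 : ℝ)..x, graphSlope hw R p lam z e₀ t := fun x hx hxR =>
    (Volterra.isPrimitiveOn_sol (hw e₀) hx hxR lam _).eq_add_integral x ⟨hx, le_rfl⟩
  -- The first function vanishes at `l' e₀`, so its value at `l e₀` is minus the integral of its
  -- slope between the two points; the order of the two lengths is irrelevant.
  have h5 : ∫ x in (l e₀)..(l' e₀), graphSlope hw R p lam z e₀ x =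
      -graphSol hw R p lam z e₀ (l e₀) := by
    have hi : ∀ a b, IntervalIntegrable (graphSlope hw R p lam z e₀) volume a b :=
      fun a b => (graphSlope hw R p lam z e₀).continuous.intervalIntegrable a b
    rw [← intervalIntegral.integral_interval_sub_left (hi 0 _) (hi 0 _)]
    rw [h4 _ hl' hlR'] at h3
    rw [h4 _ (hl e₀) (hlR e₀)]
    linear_combination h3
  simp only [boundaryValue, boundarySlope, h2, map_neg, map_zero] at h1
  rw [h5]
  linear_combination -h1

/-- The coefficient of the source term is real if the source is paired to a real number. -/
lemma IsSelfAdjoint.source_conj (hΓ : Γ.IsSelfAdjoint)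
    (hreal : ∀ e x, conj (w e x) = w e x) {l : E → ℝ} (hl : ∀ e, 0 ≤ l e)
    (hlR : ∀ e, l e ≤ R) {lam : ℝ} {z : Coeff E}
    (hz : Γ.vertexForm l (fun e => graphSol hw R p lam z e)
      (fun e => graphSlope hw R p lam z e) = 0)
    (h1 : pairing l (graphSol hw R p lam z) p = 1) : conj z.2.2 = z.2.2 := by
  have h2 := hΓ.green_eq_zero hw hreal hl hlR hz hz
  rw [← pairing_conj (f := graphSol hw R p lam z) (g := p), h1, map_one, sub_self] at h2
  linear_combination -h2

/-- If a solution without source spans the eigenspace, then the boundary value problem with that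
solution as source is nondegenerate. -/
lemma IsSelfAdjoint.injective_boundaryMap (hΓ : Γ.IsSelfAdjoint)
    (hreal : ∀ e x, conj (w e x) = w e x) (hR : ∀ e, Γ.length e ≤ R)
    (hwq : ∀ e, ∀ x ∈ Ioo 0 (Γ.length e), w e x = Γ.potential e x) {lam : ℝ} {z₀ : Coeff E}
    (hp : graphSol hw R p lam z₀ = p) (hz₀ : z₀.2.2 = 0)
    (hvert : Γ.vertexForm Γ.length (fun e => graphSol hw R p lam z₀ e)
      (fun e => graphSlope hw R p lam z₀ e) = 0) (hne : pairing Γ.length p p ≠ 0)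
    (hsimple : ∀ h, Γ.MemEigenspace lam h →
      ∃ c : ℂ, ∀ e, ∀ x ∈ Icc 0 (Γ.length e), h e x = c * p e x) :
    Function.Injective (Γ.boundaryMap hw R p Γ.length lam) := by
  have hl : ∀ e, 0 ≤ Γ.length e := fun e => (hΓ.length_pos e).le
  rw [injective_iff_map_eq_zero]
  intro z hz
  rw [boundaryMap_apply, Prod.mk_eq_zero] at hz
  -- Green's identity against `p` at the same `lam` leaves `τ ⟨p, p⟩ = 0`. So an element of the
  -- kernel has no source, is `c p` by simplicity, and `⟨c p, p⟩ = 0` forces `c = 0`.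
  have h1 := hΓ.green_eq_zero hw hreal hl hR hz.1 hvert
  rw [hp, hz.2, hz₀, mul_zero, map_zero, zero_mul, zero_add, sub_zero] at h1
  have hsrc : z.2.2 = 0 := (mul_eq_zero.1 h1).resolve_right hne
  obtain ⟨c, hc⟩ := hsimple _ (memEigenspace_graphSol hw p hΓ hR hwq hsrc hz.1)
  have hc0 : c = 0 := by
    have h2 := hz.2
    rw [pairing_congr_left hl (f' := c • p) (fun e x hx => by simpa using hc e x hx),
      pairing_smul_left] at h2
    exact (mul_eq_zero.1 h2).resolve_right hne
  simp only [hc0, zero_mul] at hc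
  have hslope : ∀ e, graphSlope hw R p lam z e 0 = 0 := fun e => by
    have h0 : (0 : ℝ) ∈ Icc 0 (Γ.length e) := ⟨le_rfl, hl e⟩
    rw [← edgeDeriv_graphSol hw p hΓ.length_pos hR z e h0,
      edgeDeriv_congr (g := fun _ _ => 0) (hc e) h0]
    simp [edgeDeriv]
  refine Prod.ext (funext fun e => ?_) (Prod.ext (funext fun e => ?_) hsrc)
  · have := hc e 0 ⟨le_rfl, hl e⟩
    rwa [graphSol, Volterra.sol_zero _ _ ((hl e).trans (hR e))] at this
  · have := hslope e
    rwa [graphSlope, Volterra.slope_zero] at this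

end QuantumGraph

/-! ### The derivative of the eigenvalue -/

theorem proposition4p1 {V E : Type*} [Finite V] [Fintype E] [DecidableEq V] [DecidableEq E]
    (Γ : QuantumGraph V E) (hΓ : Γ.IsSelfAdjoint)
    (e₀ : E) (hloose : Γ.IsLooseEdge e₀) (hDir : Γ.IsDirichletAt (Γ.vertex (e₀, true)))
    (b : ℝ) (hb : Γ.length e₀ < b)
    (hpot : MemLp (Γ.potential e₀) 2 (volume.restrict (Ioo 0 b)))
    (lam₀ : ℝ) (hlam₀ : Γ.IsSimpleEigenvalue lam₀) :
    ∃ ε > 0, ∃ δ > 0, ∃ lam : ℝ → ℝ, lam (Γ.length e₀) = lam₀ ∧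
      ∀ s : ℝ, |s - Γ.length e₀| < ε →
        (Γ.withLength e₀ s).IsSelfAdjoint ∧
        |lam s - lam₀| < δ ∧
        (Γ.withLength e₀ s).IsSimpleEigenvalue (lam s) ∧
        (∀ μ : ℝ, |μ - lam₀| < δ → (Γ.withLength e₀ s).IsEigenvalue μ → μ = lam s) ∧
        ∀ f : E → ℝ → ℂ, (Γ.withLength e₀ s).IsEigenfunction (lam s) f →
          (Γ.withLength e₀ s).IsNormalized f →
          HasDerivAt lam (-‖(Γ.withLength e₀ s).edgeDeriv f e₀ s‖ ^ 2) s := by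
  have := Fintype.ofFinite V
  have hs₀ := hΓ.length_pos e₀
  have hmax := hΓ.withLength hpot (hs₀.trans hb) le_rfl
  -- Lengths with `e₀` extended to `b`. One weight `w`, cut off at these lengths, then serves every
  -- `s ≤ b`, and `R` is a common bound for all lengths.
  set lmax := (Γ.withLength e₀ b).length with hlmax
  set R := ∑ e, lmax e with hR
  have hlmaxR : ∀ e, lmax e ≤ R := fun e =>
    Finset.single_le_sum (fun e _ => (hmax.length_pos e).le) (Finset.mem_univ e)
  have hR0 : 0 ≤ R := Finset.sum_nonneg fun e _ => (hmax.length_pos e).le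
  set w : E → ℝ → ℂ := fun e => (Ioo 0 (lmax e)).indicator fun x => (Γ.potential e x : ℂ) with hwdef
  have hw : ∀ e, Integrable (w e) := fun e => by
    rw [hwdef, integrable_indicator_iff measurableSet_Ioo]
    exact ((hmax.potential_memLp e).integrable one_le_two).ofReal
  have hreal : ∀ e x, conj (w e x) = w e x := fun e x => by
    by_cases hx : x ∈ Ioo 0 (lmax e) <;> simp [hwdef, hx]
  set L : ℝ → E → ℝ := fun s => (Γ.withLength e₀ s).length with hL
  have hLcont : Continuous L := continuous_const.update e₀ continuous_id
  have hLs : ∀ s, L s e₀ = s := fun s => by simp [hL, QuantumGraph.withLength]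
  have hLne : ∀ s t, ∀ e ≠ e₀, L s e = L t e := fun s t e he => by
    simp [hL, QuantumGraph.withLength, he]
  have hLs₀ : L (Γ.length e₀) = Γ.length := by rw [hL]; simp [QuantumGraph.withLength]
  have hLmax : ∀ s ≤ b, ∀ e, L s e ≤ lmax e := fun s hs e => by
    by_cases he : e = e₀
    · subst he; simpa [hL, hlmax, QuantumGraph.withLength] using hs
    · exact (hLne s b e he).le
  have hLR : ∀ s ≤ b, ∀ e, L s e ≤ R := fun s hs e => (hLmax s hs e).trans (hlmaxR e)
  have hsa : ∀ s, 0 < s → s ≤ b → (Γ.withLength e₀ s).IsSelfAdjoint := fun s h0 hs =>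
    hΓ.withLength hpot h0 hs
  have hwq : ∀ s ≤ b, ∀ e, ∀ x ∈ Ioo 0 (L s e), w e x = (Γ.withLength e₀ s).potential e x :=
    fun s hs e x hx => indicator_of_mem (Ioo_subset_Ioo_right (hLmax s hs e) hx) _
  have hlenR : ∀ e, Γ.length e ≤ R := by rw [← hLs₀]; exact hLR _ hb.le
  have hwq₀ : ∀ e, ∀ x ∈ Ioo 0 (Γ.length e), w e x = Γ.potential e x := by
    have := hwq _ hb.le
    rwa [hLs₀] at this
  have hlen0 : ∀ e, 0 ≤ Γ.length e := fun e => (hΓ.length_pos e).le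
  -- the unperturbed eigenfunction, extended to the whole line, serves as source term
  obtain ⟨f₀, ⟨hf₀, e₁, x₁, hx₁, hne₁⟩, hsimple⟩ := hlam₀
  obtain ⟨z₀, hz₀, hvert₀, hsol₀⟩ :=
    hf₀.exists_coeff hw 0 hΓ.length_pos hlenR hwq₀
  set p := QuantumGraph.graphSol hw R 0 lam₀ z₀ with hpdef
  have hp : QuantumGraph.graphSol hw R p lam₀ z₀ = p :=
    QuantumGraph.graphSol_congr_source hw R p 0 lam₀ hz₀
  have hvertp : Γ.vertexForm Γ.length (fun e => QuantumGraph.graphSol hw R p lam₀ z₀ e)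
      (fun e => QuantumGraph.graphSlope hw R p lam₀ z₀ e) = 0 := by
    rw [QuantumGraph.graphSlope_congr_source hw R p 0 lam₀ hz₀, hp]
    exact hvert₀
  set N := ∑ e, ∫ x in (0 : ℝ)..Γ.length e, ‖p e x‖ ^ 2 with hN
  have hNpos : 0 < N := QuantumGraph.sum_integral_norm_sq_pos hΓ.length_pos hx₁
    (by rw [← (hsol₀ e₁ x₁ hx₁).1]; exact hne₁)
  have hpp : QuantumGraph.pairing Γ.length p p = (N : ℂ) := QuantumGraph.pairing_self
  have hNC : (N : ℂ) ≠ 0 := Complex.ofReal_ne_zero.2 hNpos.ne'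
  have hinj : Function.Injective (Γ.boundaryMap hw R p Γ.length lam₀) := by
    refine hΓ.injective_boundaryMap hw hreal hlenR hwq₀ hp hz₀ hvertp (by rw [hpp]; exact hNC) ?_
    intro h hh
    obtain ⟨c, hc⟩ := hsimple h hh
    exact ⟨c, fun e x hx => by rw [hc e x hx, (hsol₀ e x hx).1]⟩
  -- the solution of the boundary value problem near the unperturbed eigenvalue
  set M : ℝ × ℝ → _ := fun q => Γ.boundaryMap hw R p (L q.1) q.2 with hM
  have hMcont : Continuous M := Γ.continuous_boundaryMap hw p hR0
    (hLcont.comp continuous_fst) continuous_snd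
  set q₀ : ℝ × ℝ := (Γ.length e₀, lam₀) with hq₀
  have hMq₀ : M q₀ = Γ.boundaryMap hw R p Γ.length lam₀ := by
    simp only [hM, hq₀, hLs₀]
  set U : ℝ × ℝ → QuantumGraph.Coeff E := fun q => (M q).inverse (0, 1) with hU
  have hev := ContinuousLinearMap.eventually_bijective_and_continuousAt_inverse Γ.finrank_coeff
    hMcont (x₀ := q₀) (by rw [hMq₀]; exact hinj) (0, 1)
  set F : ℝ × ℝ → E → ℝ →ᵇ ℂ := fun q => QuantumGraph.graphSol hw R p q.2 (U q) with hF
  set D : ℝ × ℝ → E → ℝ →ᵇ ℂ := fun q => QuantumGraph.graphSlope hw R p q.2 (U q) with hD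
  have hFcont : ∀ q, ContinuousAt U q → ContinuousAt F q := fun q hq =>
    QuantumGraph.continuousAt_graphSol hw p hR0 continuousAt_snd hq
  have hDcont : ∀ q, ContinuousAt U q → ContinuousAt D q := fun q hq =>
    QuantumGraph.continuousAt_graphSlope hw p hR0 continuousAt_snd hq
  have hpair : Continuous fun x : (E → ℝ) × (E → ℝ →ᵇ ℂ) × (E → ℝ →ᵇ ℂ) =>
      QuantumGraph.pairing x.1 x.2.1 x.2.2 :=
    QuantumGraph.continuous_pairing continuous_fst (continuous_fst.comp continuous_snd)
      (continuous_snd.comp continuous_snd)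
  have hMU : ∀ q, M q (U q) = (0, 1) →
      Γ.vertexForm (L q.1) (fun e => F q e) (fun e => D q e) = 0 ∧
      QuantumGraph.pairing (L q.1) (F q) p = 1 := fun q hq => by
    rw [← Prod.mk_inj, ← hq]; rfl
  have hU₀ := hev.self_of_nhds
  set G : ℝ × ℝ → ℝ × ℝ → ℂ := fun q r => QuantumGraph.pairing (L q.1) (F r) (F q) with hG
  have hG₀ : 0 < ‖G q₀ q₀‖ := by
    obtain ⟨e, x, hx, hxne⟩ := QuantumGraph.exists_ne_zero_of_pairing_ne_zero (l := L q₀.1) (f := F q₀)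
      (g := p) (by rw [show L q₀.1 = Γ.length from hLs₀]; exact hlen0)
      (by rw [(hMU q₀ hU₀.2.1).2]; exact one_ne_zero)
    rw [norm_pos_iff, hG]
    simp only
    rw [QuantumGraph.pairing_self, Complex.ofReal_ne_zero]
    exact (QuantumGraph.sum_integral_norm_sq_pos
      (by rw [show L q₀.1 = Γ.length from hLs₀]; exact hΓ.length_pos) hx hxne).ne'
  -- A bound at two independent points of the `(s, lam)` plane, so that it holds along the branch
  -- before continuity of `lam` is known. It also serves to compare two eigenvalues at the same `s`.
  have hGev : ∀ᶠ r in 𝓝 (q₀, q₀), ‖G q₀ q₀‖ / 2 ≤ ‖G r.1 r.2‖ := by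
    have h1 : ContinuousAt (fun r : (ℝ × ℝ) × (ℝ × ℝ) => G r.1 r.2) (q₀, q₀) := by
      refine ContinuousAt.comp (f := fun r : (ℝ × ℝ) × (ℝ × ℝ) => (L r.1.1, F r.2, F r.1))
        hpair.continuousAt ?_
      refine ContinuousAt.prodMk (hLcont.comp (continuous_fst.comp continuous_fst)).continuousAt
        (ContinuousAt.prodMk ?_ ?_)
      · exact ContinuousAt.comp (f := Prod.snd) (x := (q₀, q₀)) (hFcont q₀ hU₀.2.2) continuousAt_snd
      · exact ContinuousAt.comp (f := Prod.fst) (x := (q₀, q₀)) (hFcont q₀ hU₀.2.2) continuousAt_fst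
    have h2 : Tendsto (fun r : (ℝ × ℝ) × (ℝ × ℝ) => ‖G r.1 r.2‖) (𝓝 (q₀, q₀)) (𝓝 ‖G q₀ q₀‖) :=
      h1.norm.tendsto
    exact (h2.eventually (lt_mem_nhds (half_lt_self hG₀))).mono fun _ => le_of_lt
  have hDev : ∀ᶠ q in 𝓝 q₀, ‖D q e₀‖ ≤ ‖D q₀ e₀‖ + 1 := by
    have h1 : ContinuousAt (fun q => ‖D q e₀‖) q₀ :=
      (ContinuousAt.comp (f := D) (continuous_apply e₀).continuousAt (hDcont q₀ hU₀.2.2)).norm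
    exact (h1.eventually (gt_mem_nhds (lt_add_one _))).mono fun _ => le_of_lt
  have hposev : ∀ᶠ q : ℝ × ℝ in 𝓝 q₀, 0 < q.1 ∧ q.1 < b :=
    (continuousAt_fst.eventually (lt_mem_nhds hs₀)).and
      (continuousAt_fst.eventually (gt_mem_nhds hb))
  have hgood := hev.and (hDev.and hposev)
  have hQ := (hgood.prod_nhds hgood).and hGev
  -- Green's identity of `F` against `p` at `s = s₀`: `(lam₀ - lam) · 1 + τ N = 0`.
  have hlin : ∀ᶠ lam in 𝓝 lam₀, (U (Γ.length e₀, lam)).2.2.re = N⁻¹ * (lam - lam₀) := by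
    have h1 : ContinuousAt (fun lam : ℝ => (Γ.length e₀, lam)) lam₀ := by fun_prop
    filter_upwards [h1.eventually hev] with lam h2
    obtain ⟨h3, h4⟩ := hMU _ h2.2.1
    simp only [hLs₀] at h3 h4
    have h5 := hΓ.green_eq_zero hw hreal hlen0 hlenR h3 hvertp
    rw [hp, hpp, hz₀, map_zero, zero_mul, sub_zero] at h5
    have h6 : (U (Γ.length e₀, lam)).2.2 = ((N⁻¹ * (lam - lam₀) : ℝ) : ℂ) := by
      push_cast
      rw [eq_inv_mul_iff_mul_eq₀ hNC]
      have h7 : QuantumGraph.pairing Γ.length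
        (QuantumGraph.graphSol hw R p lam (U (Γ.length e₀, lam))) p = 1 := h4
      rw [h7] at h5
      linear_combination h5
    rw [h6, Complex.ofReal_re]
  have hTcont : ∀ᶠ q in 𝓝 q₀, ContinuousAt (fun q => (U q).2.2.re) q := hev.mono fun q hq =>
    Complex.continuous_re.continuousAt.comp hq.2.2.snd.snd
  obtain ⟨ε, hε, δ, hδ, lam, hlams₀, hlam, hbox⟩ := exists_zero_branch (inv_pos.2 hNpos) hTcont hlin
    (Q := fun q r => ((((Function.Injective (M q) ∧ M q (U q) = (0, 1) ∧ ContinuousAt U q) ∧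
      ‖D q e₀‖ ≤ ‖D q₀ e₀‖ + 1 ∧ 0 < q.1 ∧ q.1 < b) ∧
      ((Function.Injective (M r) ∧ M r (U r) = (0, 1) ∧ ContinuousAt U r) ∧
      ‖D r e₀‖ ≤ ‖D q₀ e₀‖ + 1 ∧ 0 < r.1 ∧ r.1 < b)) ∧ ‖G q₀ q₀‖ / 2 ≤ ‖G q r‖)) hQ
  refine ⟨ε, hε, δ, hδ, lam, hlams₀, fun s hs => ?_⟩
  -- facts at points of the box
  have hpt : ∀ s x, |s - Γ.length e₀| < ε → |x - lam₀| < δ →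
      (Function.Injective (M (s, x)) ∧ M (s, x) (U (s, x)) = (0, 1) ∧ ContinuousAt U (s, x)) ∧
      ‖D (s, x) e₀‖ ≤ ‖D q₀ e₀‖ + 1 ∧ 0 < s ∧ s < b := fun s x hs hx =>
    (hbox s s x x hs hs hx hx).1.1
  -- The branch only annihilates the real part of `τ`; the imaginary part vanishes by `source_conj`.
  have hzero : ∀ s, |s - Γ.length e₀| < ε → (U (s, lam s)).2.2 = 0 := by
    intro s hs
    obtain ⟨h1, h2⟩ := hlam s hs
    obtain ⟨h3, -, h4, h5⟩ := hpt s _ hs h1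
    obtain ⟨h6, h7⟩ := hMU _ h3.2.1
    have h8 := (hsa s h4 h5.le).source_conj hw hreal (fun e => ((hsa s h4 h5.le).length_pos e).le)
      (hLR s h5.le) h6 h7
    exact Complex.ext h2 (Complex.conj_eq_iff_im.1 h8)
  obtain ⟨hlams, hTs⟩ := hlam s hs
  obtain ⟨hUs, -, hs0, hsb⟩ := hpt s _ hs hlams
  have hsas := hsa s hs0 hsb.le
  have hLpos : ∀ e, 0 < L s e := hsas.length_pos
  have hLnn : ∀ e, 0 ≤ L s e := fun e => (hLpos e).le
  obtain ⟨hverts, hpairs⟩ := hMU _ hUs.2.1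
  -- every element of an eigenspace is a multiple of the solution of the boundary value problem
  have hmult : ∀ x, |x - lam₀| < δ → ∀ f, (Γ.withLength e₀ s).MemEigenspace x f →
      ∃ c : ℂ, c * (U (s, x)).2.2 = 0 ∧ ∀ e, ∀ y ∈ Icc 0 (L s e), f e y = c * F (s, x) e y ∧
        (Γ.withLength e₀ s).edgeDeriv f e y = c * D (s, x) e y := by
    intro x hx f hf
    obtain ⟨z, hz, hvert, hsol⟩ := hf.exists_coeff hw p hsas.length_pos (hLR s hsb.le)
      (hwq s hsb.le)
    obtain ⟨h1, -⟩ := hpt s x hs hx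
    set c := QuantumGraph.pairing (L s) (QuantumGraph.graphSol hw R p x z) p with hc
    -- Both sides satisfy all vertex conditions and have the same pairing with `p`.
    have h2 : z = c • U (s, x) := by
      apply h1.1
      rw [map_smul, h1.2.1]
      refine Prod.ext ?_ ?_
      · rw [Prod.smul_fst, smul_zero]
        exact hvert
      · simp [hM, QuantumGraph.boundaryMap_apply, hc]
    refine ⟨c, ?_, fun e y hy => ?_⟩
    · have h3 := congrArg (fun z : QuantumGraph.Coeff E => z.2.2) h2
      simp only [hz] at h3
      exact h3.symm
    · obtain ⟨h3, h4⟩ := hsol e y hy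
      rw [h3, h4, h2, QuantumGraph.graphSol_smul, QuantumGraph.graphSlope_smul]
      exact ⟨rfl, rfl⟩
  have hmem : (Γ.withLength e₀ s).MemEigenspace (lam s) (fun e => F (s, lam s) e) :=
    QuantumGraph.memEigenspace_graphSol hw p hsas (hLR s hsb.le) (hwq s hsb.le) (hzero s hs) hverts
  obtain ⟨e₂, x₂, hx₂, hne₂⟩ := QuantumGraph.exists_ne_zero_of_pairing_ne_zero hLnn
    (by rw [hpairs]; exact one_ne_zero)
  have hP : 0 < ∑ e, ∫ x in (0 : ℝ)..L s e, ‖F (s, lam s) e x‖ ^ 2 :=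
    QuantumGraph.sum_integral_norm_sq_pos hLpos hx₂ hne₂
  refine ⟨hsas, hlams, ⟨fun e => F (s, lam s) e, ⟨hmem, e₂, x₂, hx₂, hne₂⟩, fun h hh => ?_⟩,
    fun μ hμ hev => ?_, fun f hf hnorm => ?_⟩
  · obtain ⟨c, -, hc⟩ := hmult _ hlams h hh
    exact ⟨c, fun e x hx => (hc e x hx).1⟩
  · obtain ⟨f, hf, e, x, hx, hfx⟩ := hev
    obtain ⟨c, hc0, hc⟩ := hmult μ hμ f hf
    have hcne : c ≠ 0 := by
      rintro rfl
      exact hfx (by rw [(hc e x hx).1, zero_mul])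
    have hsrc := (mul_eq_zero.1 hc0).resolve_left hcne
    obtain ⟨⟨-, h1⟩, h2⟩ := hbox s s (lam s) μ hs hs hlams hμ
    obtain ⟨h3, -⟩ := hMU _ h1.1.2.1
    -- Both sources vanish, so only `(lam s - μ) ⟨F(s, μ), F(s, lam s)⟩ = 0` remains.
    have h4 := hsas.green_eq_zero hw hreal hLnn (hLR s hsb.le) h3 hverts
    rw [hsrc, hzero s hs, map_zero, zero_mul, zero_mul, add_zero, sub_zero] at h4
    have h5 : G (s, lam s) (s, μ) ≠ 0 := by
      rw [← norm_pos_iff]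
      exact (half_pos hG₀).trans_le h2
    have h6 := (mul_eq_zero.1 h4).resolve_right h5
    exact_mod_cast (sub_eq_zero.1 h6).symm
  · obtain ⟨c, -, hc⟩ := hmult _ hlams f hf.1
    set P := ∑ e, ∫ x in (0 : ℝ)..L s e, ‖F (s, lam s) e x‖ ^ 2 with hPdef
    -- Normalization of `f = c F` turns `‖F_s'(s)‖² / P` into `‖f'(s)‖²`, whatever the phase of `c`.
    have hcP : ‖c‖ ^ 2 * P = 1 := by
      rw [← hnorm, hPdef, Finset.mul_sum]
      refine Finset.sum_congr rfl fun e _ => ?_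
      rw [← intervalIntegral.integral_const_mul]
      refine intervalIntegral.integral_congr fun x hx => ?_
      rw [uIcc_of_le (hLnn e)] at hx
      simp only [(hc e x hx).1, norm_mul, mul_pow]
    have hfd : ‖(Γ.withLength e₀ s).edgeDeriv f e₀ s‖ ^ 2 = ‖D (s, lam s) e₀ s‖ ^ 2 / P := by
      rw [(hc e₀ s ⟨hs0.le, (hLs s).ge⟩).2, norm_mul, mul_pow, eq_div_iff hP.ne']
      linear_combination ‖D (s, lam s) e₀ s‖ ^ 2 * hcP
    rw [hfd]
    have hnear : ∀ᶠ t in 𝓝 s, |t - Γ.length e₀| < ε :=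
      (by fun_prop : Continuous fun t => |t - Γ.length e₀|).continuousAt.eventually
        (gt_mem_nhds hs)
    have hcurve : ContinuousAt lam s → ContinuousAt (fun t => (t, lam t)) s := fun h =>
      continuousAt_id.prodMk h
    refine hasDerivAt_of_quotient (v := fun t => D (t, lam t) e₀)
      (G := fun t => G (s, lam s) (t, lam t)) (C := ‖D q₀ e₀‖ + 1) (half_pos hG₀) ?_ ?_ ?_ ?_ ?_ ?_
    · filter_upwards [hnear] with t ht
      exact (hbox s t _ _ hs ht hlams (hlam t ht).1).2
    · filter_upwards [hnear] with t ht
      exact (hpt t _ ht (hlam t ht).1).2.1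
    · intro h
      have h1 : ContinuousAt (fun t => D (t, lam t)) s :=
        ContinuousAt.comp (f := fun t => (t, lam t)) (hDcont _ hUs.2.2) (hcurve h)
      exact ContinuousAt.comp (f := fun t => D (t, lam t)) (continuous_apply e₀).continuousAt h1
    · intro h
      have h1 : ContinuousAt (fun t => F (t, lam t)) s :=
        ContinuousAt.comp (f := fun t => (t, lam t)) (hFcont _ hUs.2.2) (hcurve h)
      exact ContinuousAt.comp (f := fun t => (L s, F (t, lam t), F (s, lam s)))
        hpair.continuousAt (continuousAt_const.prodMk (h1.prodMk continuousAt_const))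
    · exact QuantumGraph.pairing_self
    · filter_upwards [hnear] with t ht
      obtain ⟨h1, -, ht0, htb⟩ := hpt t _ ht (hlam t ht).1
      have h2 := hΓ.green_of_isLooseEdge hw hreal hloose hDir hLnn (hLR s hsb.le) (l' := L t)
        (by rw [hLs]; exact ht0.le) (hLR t htb.le e₀) (hLne t s) (hMU _ h1.2.1).1 hverts
        (hzero t ht) (hzero s hs)
      rw [hLs, hLs] at h2
      exact h2
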